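/- Let $n \in \mathbb N_0$, $1 < p < \infty$ and $t > 0$. Write $w\cdot\bar z=\sum_j w_j\overline{z_j}$, let $V$ be Lebesgue measure on $\mathbb C^n$ and, for $s>0$, put $f_s(z) = (\pi s)^{-n} e^{-|z|^2/s}$ and $d\mu_s = f_s\,dV$. Let $F_t^p$ be the Banach space of entire functions on $\mathbb C^n$ that belong to $L^p(\mathbb C^n,\mu_{2t/p})$, with the norm of that space, and let $\mathcal L(F_t^p)$ be the algebra of bounded linear operators on it. For $f\in L^\infty(\mathbb C^n)$ let $T_f^t\in\mathcal L(F_t^p)$ be the Toeplitz operator $$T_f^t g(z)=\int_{\mathbb C^n} e^{z\cdot\bar w/t} f(w)g(w)\,d\mu_t(w).$$ For $z\in\mathbb C^n$ let $W_z\in\mathcal L(F_t^p)$ be the Weyl operator $W_zf(w)=e^{w\cdot\bar z/t-|z|^2/(2t)}f(w-z)$. For $g\in L^1(\mathbb C^n)$ and $A\in\mathcal L(F_t^p)$ let $g*A=\int_{\mathbb C^n} g(z)\,W_zAW_{-z}\,dV(z)\in\mathcal L(F_t^p)$ (an integral in the strong operator topology). Let $\mathcal T^{p,t}$ be the full Toeplitz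 algebra, i.e. the smallest norm-closed subalgebra of $\mathcal L(F_t^p)$ that contains all $T_f^t$ with $f\in L^\infty(\mathbb C^n)$; let $\mathcal T^{p,t}_{lin}(\mathrm{BUC}(\mathbb C^n))$ be the norm-closed linear span of the operators $T_f^t$ with $f$ bounded and uniformly continuous on $\mathbb C^n$; and let $\mathcal C_1$ be the set of all $A\in\mathcal L(F_t^p)$ for which $z\mapsto W_zAW_{-z}$ is continuous with respect to the operator norm. Then $$\mathcal T^{p,t}=\mathcal T^{p,t}_{lin}(\mathrm{BUC}(\mathbb C^n))=\mathcal C_1=\{A\in\mathcal L(F_t^p):\ f_s*A\to A\text{ in operator norm as }s\to0^+\}=\{g*A:\ g\in L^1(\mathbb C^n),\ A\in\mathcal C_1\}.$$ -/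

import Mathlib

open MeasureTheory Filter Topology
open scoped ENNReal NNReal

noncomputable section

namespace Fock

/-- `ℂⁿ` with its Euclidean norm; `volume` on it is Lebesgue measure on `ℝ²ⁿ`.
The bilinear expression `w · z̄ = ∑ wᵢ z̄ᵢ` is `inner ℂ z w`. -/
abbrev Cn (n : ℕ) : Type := EuclideanSpace ℂ (Fin n)

/-- The density `(π t)⁻ⁿ exp (-|z|² / t)`. -/
def gaussian (n : ℕ) (t : ℝ) (z : Cn n) : ℝ :=
  1 / (Real.pi * t) ^ n * Real.exp (-(‖z‖ ^ 2 / t))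

/-- The Gaussian measure `μ_t` on `ℂⁿ`. -/
def gaussianMeasure (n : ℕ) (t : ℝ) : Measure (Cn n) :=
  volume.withDensity fun z => ENNReal.ofReal (gaussian n t z)

/-- The entire functions on `ℂⁿ` that lie in `L^p(μ_{2t/p})`. -/
def fockSubmodule (n : ℕ) (p t : ℝ) : Submodule ℂ (Cn n → ℂ) where
  carrier := {f | Differentiable ℂ f ∧
    MemLp f (ENNReal.ofReal p) (gaussianMeasure n (2 * t / p))}
  zero_mem' := ⟨differentiable_const 0, MemLp.zero⟩
  add_mem' hf hg := ⟨hf.1.add hg.1, hf.2.add hg.2⟩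
  smul_mem' c _ hf := ⟨hf.1.const_smul c, hf.2.const_smul c⟩

/-- The `p`-Fock space `F_t^p`; its elements are honest entire functions. -/
def FockSpace (n : ℕ) (p t : ℝ) : Type := fockSubmodule n p t

instance (n : ℕ) (p t : ℝ) : AddCommGroup (FockSpace n p t) :=
  inferInstanceAs (AddCommGroup (fockSubmodule n p t))

instance (n : ℕ) (p t : ℝ) : Module ℂ (FockSpace n p t) :=
  inferInstanceAs (Module ℂ (fockSubmodule n p t))

instance (n : ℕ) (p t : ℝ) : CoeFun (FockSpace n p t) fun _ => Cn n → ℂ :=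
  ⟨fun f => f.1⟩

variable {n : ℕ} {p t : ℝ}

theorem FockSpace.ext {f g : FockSpace n p t} (h : ∀ z, f z = g z) : f = g :=
  Subtype.ext (funext h)

theorem FockSpace.continuous (f : FockSpace n p t) : Continuous f := f.2.1.continuous

theorem FockSpace.memLp (f : FockSpace n p t) :
    MemLp f (ENNReal.ofReal p) (gaussianMeasure n (2 * t / p)) := f.2.2

theorem continuous_gaussian (n : ℕ) (t : ℝ) : Continuous (gaussian n t) := by
  unfold gaussian; fun_prop

theorem gaussian_pos (n : ℕ) {t : ℝ} (ht : 0 < t) (z : Cn n) : 0 < gaussian n t z := by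
  unfold gaussian; have := Real.pi_pos; positivity

theorem lintegral_gaussianMeasure (n : ℕ) (t : ℝ) (h : Cn n → ℝ≥0∞) :
    ∫⁻ z, h z ∂(gaussianMeasure n t) = ∫⁻ z, ENNReal.ofReal (gaussian n t z) * h z := by
  unfold gaussianMeasure
  rw [lintegral_withDensity_eq_lintegral_mul_non_measurable]
  · rfl
  · exact (continuous_gaussian n t).measurable.ennreal_ofReal
  · exact Eventually.of_forall fun _ => ENNReal.ofReal_lt_top

theorem integral_gaussianMeasure (n : ℕ) {t : ℝ} (ht : 0 < t) (h : Cn n → ℂ) :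
    ∫ z, h z ∂(gaussianMeasure n t) = ∫ z, (gaussian n t z : ℂ) * h z := by
  unfold gaussianMeasure
  rw [integral_withDensity_eq_integral_toReal_smul
    (continuous_gaussian n t).measurable.ennreal_ofReal
    (Eventually.of_forall fun _ => ENNReal.ofReal_lt_top)]
  refine integral_congr_ae (Eventually.of_forall fun z => ?_)
  simp only [ENNReal.toReal_ofReal (gaussian_pos n ht z).le, Complex.real_smul]

theorem volume_absolutelyContinuous (n : ℕ) {t : ℝ} (ht : 0 < t) :
    (volume : Measure (Cn n)) ≪ gaussianMeasure n t := by
  refine withDensity_absolutelyContinuous' ?_ ?_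
  · exact (continuous_gaussian n t).measurable.ennreal_ofReal.aemeasurable
  · exact Eventually.of_forall fun z => by simpa using gaussian_pos n ht z

/-- The `p`-th power of the norm with the weight moved to the function, up to a constant. -/
def weightedLint (p t : ℝ) (f : Cn n → ℂ) : ℝ≥0∞ :=
  ∫⁻ z, (‖f z‖ₑ * ENNReal.ofReal (Real.exp (-(‖z‖ ^ 2 / (2 * t))))) ^ p

theorem lintegral_enorm_rpow (hp : 0 < p) (ht : 0 < t) (f : Cn n → ℂ) :
    ∫⁻ z, ‖f z‖ₑ ^ p ∂(gaussianMeasure n (2 * t / p)) =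
      ENNReal.ofReal (1 / (Real.pi * (2 * t / p)) ^ n) * weightedLint p t f := by
  have hpi := Real.pi_pos
  rw [lintegral_gaussianMeasure, weightedLint, ← lintegral_const_mul' _ _ ENNReal.ofReal_ne_top]
  refine lintegral_congr fun z => ?_
  rw [gaussian, ENNReal.ofReal_mul (by positivity), mul_assoc, ENNReal.mul_rpow_of_nonneg _ _ hp.le,
    ENNReal.ofReal_rpow_of_pos (Real.exp_pos _), ← Real.exp_mul, mul_comm (‖f z‖ₑ ^ p)]
  congr 4
  field_simp

theorem eLpNorm_eq (hp : 0 < p) (ht : 0 < t) (f : Cn n → ℂ) :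
    eLpNorm f (ENNReal.ofReal p) (gaussianMeasure n (2 * t / p)) =
      (ENNReal.ofReal (1 / (Real.pi * (2 * t / p)) ^ n) * weightedLint p t f) ^ (1 / p) := by
  rw [eLpNorm_eq_lintegral_rpow_enorm_toReal (by simpa using hp) ENNReal.ofReal_ne_top,
    ENNReal.toReal_ofReal hp.le, lintegral_enorm_rpow hp ht]

theorem eLpNorm_ne_top_iff (hp : 0 < p) (ht : 0 < t) (f : Cn n → ℂ) :
    eLpNorm f (ENNReal.ofReal p) (gaussianMeasure n (2 * t / p)) ≠ ∞ ↔
      weightedLint p t f ≠ ∞ := by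
  have hpi := Real.pi_pos
  have hc : ENNReal.ofReal (1 / (Real.pi * (2 * t / p)) ^ n) ≠ 0 := by
    simp only [ne_eq, ENNReal.ofReal_eq_zero, not_le]; positivity
  have h1 : 0 < 1 / p := by positivity
  rw [eLpNorm_eq hp ht, ne_eq, ne_eq, ENNReal.rpow_eq_top_iff_of_pos h1,
    ENNReal.mul_eq_top]
  simp only [hc, ne_eq, not_false_eq_true, true_and, ENNReal.ofReal_ne_top, false_and, or_false]

instance [Fact (1 < p)] [Fact (0 < t)] : NormedAddCommGroup (FockSpace n p t) :=
  AddGroupNorm.toNormedAddCommGroup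
    { toFun := fun f =>
        (eLpNorm f (ENNReal.ofReal p) (gaussianMeasure n (2 * t / p))).toReal
      map_zero' := by
        change (eLpNorm (0 : Cn n → ℂ) _ _).toReal = 0
        simp
      add_le' := fun f g => by
        have hp : 1 < p := Fact.out
        change (eLpNorm ((f : Cn n → ℂ) + (g : Cn n → ℂ)) _ _).toReal ≤ _
        rw [← ENNReal.toReal_add f.memLp.2.ne g.memLp.2.ne]
        exact ENNReal.toReal_mono (ENNReal.add_ne_top.2 ⟨f.memLp.2.ne, g.memLp.2.ne⟩)
          (eLpNorm_add_le f.memLp.1 g.memLp.1 (by simpa using hp.le))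
      neg' := fun f => by
        change (eLpNorm (-(f : Cn n → ℂ)) _ _).toReal = _
        rw [eLpNorm_neg]
      eq_zero_of_map_eq_zero' := fun f hf => by
        have hp : 1 < p := Fact.out
        have ht : 0 < t := Fact.out
        have hp0 : 0 < p := by linarith
        have h0 := ((ENNReal.toReal_eq_zero_iff _).1 hf).resolve_right f.memLp.2.ne
        rw [eLpNorm_eq_zero_iff f.memLp.1 (by simpa using hp0)] at h0
        have h1 := (volume_absolutelyContinuous n
          (show 0 < 2 * t / p by positivity)).ae_le h0
        have h2 := f.continuous.ae_eq_iff_eq volume continuous_zero |>.1 h1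
        exact FockSpace.ext fun z => congrFun h2 z }

theorem FockSpace.norm_def [Fact (1 < p)] [Fact (0 < t)] (f : FockSpace n p t) :
    ‖f‖ = (eLpNorm f (ENNReal.ofReal p) (gaussianMeasure n (2 * t / p))).toReal := rfl

instance [Fact (1 < p)] [Fact (0 < t)] : NormedSpace ℂ (FockSpace n p t) where
  norm_smul_le c f := by
    rw [FockSpace.norm_def, FockSpace.norm_def]
    change (eLpNorm (c • (f : Cn n → ℂ)) _ _).toReal ≤ _
    rw [eLpNorm_const_smul, ENNReal.toReal_mul, toReal_enorm]

theorem FockSpace.norm_rpow [Fact (1 < p)] [Fact (0 < t)] (f : FockSpace n p t) :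
    ‖f‖ = (1 / (Real.pi * (2 * t / p)) ^ n * (weightedLint p t f).toReal) ^ (1 / p) := by
  have hp : 1 < p := Fact.out
  have ht : 0 < t := Fact.out
  have hpi := Real.pi_pos
  rw [FockSpace.norm_def, eLpNorm_eq (by linarith) ht, ← ENNReal.toReal_rpow, ENNReal.toReal_mul,
    ENNReal.toReal_ofReal (by positivity)]

theorem FockSpace.weightedLint_ne_top [Fact (1 < p)] [Fact (0 < t)] (f : FockSpace n p t) :
    weightedLint p t f ≠ ∞ := by
  have hp : 1 < p := Fact.out
  exact (eLpNorm_ne_top_iff (by linarith) Fact.out f).1 f.memLp.2.ne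

/-- An entire function with finite weighted integral belongs to the Fock space. -/
def FockSpace.mk' [Fact (1 < p)] [Fact (0 < t)] (f : Cn n → ℂ) (hf : Differentiable ℂ f)
    (h : weightedLint p t f ≠ ∞) : FockSpace n p t :=
  ⟨f, hf, hf.continuous.aestronglyMeasurable, lt_top_iff_ne_top.2 <|
    (eLpNorm_ne_top_iff (lt_trans one_pos Fact.out) Fact.out f).2 h⟩

/-! ### Weyl operators -/

/-- The normalized reproducing kernel `k_z^t`. -/
def normalizedKernel (t : ℝ) (z w : Cn n) : ℂ :=
  Complex.exp (inner ℂ z w / t - (‖z‖ ^ 2 / (2 * t) : ℝ))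

theorem differentiable_normalizedKernel (t : ℝ) (z : Cn n) :
    Differentiable ℂ (normalizedKernel t z) := by
  have h : Differentiable ℂ (fun w : Cn n => inner ℂ z w) := (innerSL ℂ z).differentiable
  unfold normalizedKernel
  fun_prop

theorem norm_normalizedKernel_mul (ht : 0 < t) (z w : Cn n) :
    ‖normalizedKernel t z w‖ * Real.exp (-(‖w‖ ^ 2 / (2 * t))) =
      Real.exp (-(‖w - z‖ ^ 2 / (2 * t))) := by
  rw [normalizedKernel, Complex.norm_exp, ← Real.exp_add]
  congr 1
  rw [@norm_sub_sq ℂ, ← inner_re_symm]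
  simp only [Complex.sub_re, Complex.ofReal_re, Complex.div_ofReal_re, RCLike.re_to_complex]
  field_simp
  ring

theorem weightedLint_weyl (ht : 0 < t) (f : Cn n → ℂ) (z : Cn n) :
    weightedLint p t (fun w => normalizedKernel t z w * f (w - z)) = weightedLint p t f := by
  unfold weightedLint
  rw [← lintegral_sub_right_eq_self
    (fun w : Cn n => (‖f w‖ₑ * ENNReal.ofReal (Real.exp (-(‖w‖ ^ 2 / (2 * t))))) ^ p) z]
  refine lintegral_congr fun w => ?_
  rw [← norm_normalizedKernel_mul ht z w, ENNReal.ofReal_mul (norm_nonneg _), enorm_mul,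
    ofReal_norm]
  ring_nf

/-- The Weyl operator `(W_z f)(w) = k_z^t(w) f(w - z)` on `F_t^p`. -/
def weyl [Fact (1 < p)] [Fact (0 < t)] (z : Cn n) : FockSpace n p t →L[ℂ] FockSpace n p t :=
  LinearMap.mkContinuous
    { toFun := fun f => FockSpace.mk' (fun w => normalizedKernel t z w * f (w - z))
        ((differentiable_normalizedKernel t z).mul
          (f.2.1.comp (differentiable_id.sub_const z)))
        (by rw [weightedLint_weyl Fact.out]; exact f.weightedLint_ne_top)
      map_add' := fun f g => FockSpace.ext fun w => mul_add _ (f (w - z)) (g (w - z))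
      map_smul' := fun c f => FockSpace.ext fun w => mul_left_comm _ c (f (w - z)) }
    1 fun f => by
      rw [one_mul, FockSpace.norm_rpow, FockSpace.norm_rpow f]
      exact (congrArg (fun a : ℝ≥0∞ => (1 / (Real.pi * (2 * t / p)) ^ n * a.toReal) ^ (1 / p))
        (weightedLint_weyl Fact.out f z)).le

theorem weyl_apply [Fact (1 < p)] [Fact (0 < t)] (z w : Cn n) (f : FockSpace n p t) :
    weyl z f w = normalizedKernel t z w * f (w - z) := rfl

theorem norm_weyl [Fact (1 < p)] [Fact (0 < t)] (z : Cn n) (f : FockSpace n p t) :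
    ‖weyl z f‖ = ‖f‖ := by
  rw [FockSpace.norm_rpow, FockSpace.norm_rpow f]
  exact congrArg (fun a : ℝ≥0∞ => (1 / (Real.pi * (2 * t / p)) ^ n * a.toReal) ^ (1 / p))
    (weightedLint_weyl Fact.out f z)

theorem continuous_normalizedKernel_left (t : ℝ) (w : Cn n) :
    Continuous fun z : Cn n => normalizedKernel t z w := by
  unfold normalizedKernel; fun_prop

theorem tendsto_weightedLint_weyl_sub (hp : 1 < p) (ht : 0 < t) {f : Cn n → ℂ}
    (hf : Continuous f) (hN : weightedLint p t f ≠ ∞) {u : ℕ → Cn n} {z : Cn n}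
    (hu : Tendsto u atTop (𝓝 z)) :
    Tendsto (fun k => weightedLint p t fun w => normalizedKernel t (u k) w * f (w - u k) -
      normalizedKernel t z w * f (w - z)) atTop (𝓝 0) := by
  have hp0 : 0 < p := by linarith
  have hker : ∀ z : Cn n, Continuous (normalizedKernel t z) := fun z =>
    (differentiable_normalizedKernel t z).continuous
  set ω : Cn n → ℝ≥0∞ := fun w => ENNReal.ofReal (Real.exp (-(‖w‖ ^ 2 / (2 * t)))) with hω
  have hωm : Measurable ω := by
    refine Measurable.ennreal_ofReal (Continuous.measurable ?_); fun_prop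
  set F : Cn n → Cn n → ℂ := fun z w => normalizedKernel t z w * f (w - z) with hF
  have hFc : ∀ z, Continuous (F z) := fun z =>
    (hker z).mul (hf.comp (continuous_id.sub continuous_const))
  set a : Cn n → Cn n → ℝ≥0∞ := fun z w => (‖F z w‖ₑ * ω w) ^ p with ha
  set d : ℕ → Cn n → ℝ≥0∞ := fun k w => (‖F (u k) w - F z w‖ₑ * ω w) ^ p with hd
  have ham : ∀ z, Measurable (a z) := fun z =>
    ((hFc z).measurable.enorm.mul hωm).pow_const p
  have hdm : ∀ k, Measurable (d k) := fun k =>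
    ((((hFc (u k)).sub (hFc z)).measurable.enorm).mul hωm).pow_const p
  have haN : ∀ z, ∫⁻ w, a z w = weightedLint p t f := fun z => weightedLint_weyl ht f z
  have hafin : ∀ z w, a z w ≠ ∞ := fun z w =>
    ENNReal.rpow_ne_top_of_nonneg hp0.le (ENNReal.mul_ne_top enorm_ne_top ENNReal.ofReal_ne_top)
  set c : ℝ≥0∞ := 2 ^ (p - 1) with hc
  have hcfin : c ≠ ∞ := ENNReal.rpow_ne_top_of_nonneg (by linarith) (by simp)
  set S : ℕ → Cn n → ℝ≥0∞ := fun k w => c * (a (u k) w + a z w) with hS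
  have hSm : ∀ k, Measurable (S k) := fun k => ((ham _).add (ham _)).const_mul c
  set M : ℝ≥0∞ := c * (weightedLint p t f + weightedLint p t f) with hM
  have hMfin : M ≠ ∞ := ENNReal.mul_ne_top hcfin (ENNReal.add_ne_top.2 ⟨hN, hN⟩)
  have hSM : ∀ k, ∫⁻ w, S k w = M := fun k => by
    have h1 : ∫⁻ w, S k w = c * ∫⁻ w, (a (u k) w + a z w) :=
      lintegral_const_mul _ ((ham _).add (ham _))
    rw [h1, lintegral_add_left (ham _), haN, haN]
  have hdS : ∀ k w, d k w ≤ S k w := fun k w => by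
    refine le_trans (ENNReal.rpow_le_rpow ?_ hp0.le)
      (ENNReal.rpow_add_le_mul_rpow_add_rpow _ _ hp.le)
    rw [← add_mul]
    exact mul_le_mul_left enorm_sub_le (ω w)
  have hdM : ∀ k, ∫⁻ w, d k w ≠ ∞ := fun k =>
    ne_top_of_le_ne_top hMfin ((lintegral_mono (hdS k)).trans_eq (hSM k))
  have hGM : ∀ k, ∫⁻ w, (S k w - d k w) = M - ∫⁻ w, d k w := fun k => by
    rw [lintegral_sub (hdm k) (hdM k) (Eventually.of_forall (hdS k)), hSM]
  have hlimF : ∀ w, Tendsto (fun k => F (u k) w) atTop (𝓝 (F z w)) := fun w => by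
    have h1 : Continuous fun z : Cn n => F z w :=
      (continuous_normalizedKernel_left t w).mul (hf.comp (continuous_const.sub continuous_id))
    exact (h1.tendsto z).comp hu
  have hlima : ∀ w, Tendsto (fun k => a (u k) w) atTop (𝓝 (a z w)) := fun w =>
    ((ENNReal.continuous_rpow_const (y := p)).tendsto _).comp
      (ENNReal.Tendsto.mul_const (hlimF w).enorm (Or.inr ENNReal.ofReal_ne_top))
  have hlimd : ∀ w, Tendsto (fun k => d k w) atTop (𝓝 0) := fun w => by
    have h1 : Tendsto (fun k => ‖F (u k) w - F z w‖ₑ) atTop (𝓝 0) := by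
      simpa using ((hlimF w).sub_const (F z w)).enorm
    have h2 := ENNReal.Tendsto.mul_const (b := ω w) h1 (Or.inr ENNReal.ofReal_ne_top)
    have h3 := ((ENNReal.continuous_rpow_const (y := p)).tendsto _).comp h2
    rw [zero_mul, ENNReal.zero_rpow_of_pos hp0] at h3
    exact h3
  have hlimG : ∀ w, Tendsto (fun k => S k w - d k w) atTop (𝓝 (c * (a z w + a z w))) := fun w => by
    have h1 : Tendsto (fun k => S k w) atTop (𝓝 (c * (a z w + a z w))) :=
      ENNReal.Tendsto.const_mul ((hlima w).add_const _) (Or.inr hcfin)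
    simpa using ENNReal.Tendsto.sub h1 (hlimd w) (Or.inr ENNReal.zero_ne_top)
  have hfatou : M ≤ liminf (fun k => ∫⁻ w, (S k w - d k w)) atTop := by
    have h1 := lintegral_liminf_le (μ := (volume : Measure (Cn n))) (u := atTop)
      (fun k => (hSm k).sub (hdm k))
    refine le_trans (le_of_eq ?_) h1
    have h2 : ∀ w, liminf (fun k => (S k - d k) w) atTop = c * (a z w + a z w) := fun w =>
      (hlimG w).liminf_eq
    have h3 : ∫⁻ w, c * (a z w + a z w) = c * ∫⁻ w, (a z w + a z w) :=
      lintegral_const_mul _ ((ham _).add (ham _))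
    rw [lintegral_congr h2, h3, lintegral_add_left (ham _), haN]
  have hGtend : Tendsto (fun k => ∫⁻ w, (S k w - d k w)) atTop (𝓝 M) := by
    refine tendsto_of_le_liminf_of_limsup_le hfatou ?_
    refine limsup_le_of_le (by isBoundedDefault) (Eventually.of_forall fun k => ?_)
    rw [hGM]; exact tsub_le_self
  have hD : ∀ k, ∫⁻ w, d k w = M - ∫⁻ w, (S k w - d k w) := fun k => by
    rw [hGM, ENNReal.sub_sub_cancel hMfin]
    exact (lintegral_mono (hdS k)).trans_eq (hSM k)
  change Tendsto (fun k => ∫⁻ w, d k w) atTop (𝓝 0)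
  simp_rw [hD]
  simpa using ENNReal.Tendsto.sub (tendsto_const_nhds (x := M)) hGtend (Or.inl hMfin)

theorem continuous_weyl_apply [Fact (1 < p)] [Fact (0 < t)] (f : FockSpace n p t) :
    Continuous fun z : Cn n => weyl z f := by
  have hp : 1 < p := Fact.out
  have hp0 : 0 < 1 / p := by positivity
  refine continuous_iff_continuousAt.2 fun z => tendsto_of_seq_tendsto fun u hu => ?_
  rw [tendsto_iff_norm_sub_tendsto_zero]
  simp_rw [FockSpace.norm_rpow]
  have h1 := (ENNReal.tendsto_toReal ENNReal.zero_ne_top).comp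
    (tendsto_weightedLint_weyl_sub (p := p) (t := t) hp Fact.out f.continuous
      f.weightedLint_ne_top hu)
  have h2 := (h1.const_mul (1 / (Real.pi * (2 * t / p)) ^ n)).rpow_const
    (p := 1 / p) (Or.inr hp0.le)
  rw [ENNReal.toReal_zero, mul_zero, Real.zero_rpow hp0.ne'] at h2
  exact h2

/-- The action `α_z(A) = W_z A W_{-z}`. -/
def translate [Fact (1 < p)] [Fact (0 < t)] (z : Cn n)
    (A : FockSpace n p t →L[ℂ] FockSpace n p t) : FockSpace n p t →L[ℂ] FockSpace n p t :=
  weyl z ∘L A ∘L weyl (-z)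

theorem continuous_translate_apply [Fact (1 < p)] [Fact (0 < t)]
    (A : FockSpace n p t →L[ℂ] FockSpace n p t) (x : FockSpace n p t) :
    Continuous fun z : Cn n => translate z A x := by
  have hy : Continuous fun z : Cn n => A (weyl (-z) x) :=
    A.continuous.comp ((continuous_weyl_apply x).comp continuous_neg)
  refine continuous_iff_continuousAt.2 fun z => ?_
  rw [ContinuousAt, tendsto_iff_norm_sub_tendsto_zero]
  have h1 := tendsto_iff_norm_sub_tendsto_zero.1 (hy.tendsto z)
  have h2 := tendsto_iff_norm_sub_tendsto_zero.1
    ((continuous_weyl_apply (A (weyl (-z) x))).tendsto z)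
  refine squeeze_zero (fun _ => norm_nonneg _) (fun v => ?_) (by simpa using h1.add h2)
  calc ‖translate v A x - translate z A x‖
      = ‖weyl v (A (weyl (-v) x) - A (weyl (-z) x)) +
          (weyl v (A (weyl (-z) x)) - weyl z (A (weyl (-z) x)))‖ := by
        rw [map_sub]; simp [translate]
    _ ≤ _ := (norm_add_le _ _).trans_eq (by rw [norm_weyl])

theorem norm_translate_apply_le [Fact (1 < p)] [Fact (0 < t)] (z : Cn n)
    (A : FockSpace n p t →L[ℂ] FockSpace n p t) (x : FockSpace n p t) :
    ‖translate z A x‖ ≤ ‖A‖ * ‖x‖ := by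
  change ‖weyl z (A (weyl (-z) x))‖ ≤ _
  rw [norm_weyl]
  exact (A.le_opNorm _).trans_eq (by rw [norm_weyl])

theorem integrable_smul_translate [Fact (1 < p)] [Fact (0 < t)] {g : Cn n → ℂ}
    (hg : Integrable g) (A : FockSpace n p t →L[ℂ] FockSpace n p t) (x : FockSpace n p t) :
    Integrable fun z => g z • translate z A x := by
  refine Integrable.mono' (hg.norm.mul_const (‖A‖ * ‖x‖))
    (hg.1.smul (continuous_translate_apply A x).aestronglyMeasurable)
    (Eventually.of_forall fun z => ?_)
  rw [norm_smul]
  exact mul_le_mul_of_nonneg_left (norm_translate_apply_le z A x) (norm_nonneg _)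

open scoped Classical in
/-- The convolution `g ∗ A = ∫ g(z) W_z A W_{-z} dV(z)` of `g ∈ L¹(ℂⁿ)` and a bounded operator `A`.
The integral converges in the strong operator topology: `(g ∗ A) x = ∫ g(z) W_z A W_{-z} x dV(z)`
is a Bochner integral in the Banach space `F_t^p`. (The value for non-integrable `g` is irrelevant.) -/
def conv [Fact (1 < p)] [Fact (0 < t)] (g : Cn n → ℂ)
    (A : FockSpace n p t →L[ℂ] FockSpace n p t) : FockSpace n p t →L[ℂ] FockSpace n p t :=
  if hg : Integrable g then
    LinearMap.mkContinuous
      { toFun := fun x => ∫ z, g z • translate z A x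
        map_add' := fun x y => by
          simp_rw [map_add, smul_add]
          exact integral_add (integrable_smul_translate hg A x) (integrable_smul_translate hg A y)
        map_smul' := fun c x => by
          simp_rw [map_smul, smul_comm _ c]
          exact integral_smul c _ }
      ((∫ z, ‖g z‖) * ‖A‖) fun x => by
        refine (norm_integral_le_integral_norm _).trans ?_
        rw [mul_assoc, ← integral_mul_const]
        refine integral_mono (integrable_smul_translate hg A x).norm
          (hg.norm.mul_const _) fun z => ?_
        simp only [norm_smul]
        exact mul_le_mul_of_nonneg_left (norm_translate_apply_le z A x) (norm_nonneg _)
  else 0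

/-! ### Toeplitz operators -/

/-- The integral operator `P_t h (z) = ∫ exp (z · w̄ / t) h(w) dμ_t(w)`. -/
def bergmanProj (t : ℝ) (h : Cn n → ℂ) (z : Cn n) : ℂ :=
  ∫ w, Complex.exp (inner ℂ w z / t) * h w ∂(gaussianMeasure n t)

theorem integrable_exp_neg (n : ℕ) {b : ℝ} (hb : 0 < b) :
    Integrable fun w : Cn n => Real.exp (-(b * ‖w‖ ^ 2)) := by
  have h := (GaussianFourier.integrable_cexp_neg_mul_sq_norm_add (b := (b : ℂ)) (V := Cn n)
    (by simpa using hb) 0 0).norm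
  refine h.congr (Eventually.of_forall fun w => ?_)
  simp only [Complex.norm_exp]
  congr 1
  rw [zero_mul, add_zero, ← Complex.ofReal_pow, ← Complex.ofReal_neg, ← Complex.ofReal_mul,
    Complex.ofReal_re, neg_mul]

theorem integrable_weighted (hp : 1 < p) {h : Cn n → ℂ}
    (hm : AEStronglyMeasurable h) (hN : weightedLint p t h ≠ ∞) {b : ℝ} (hb : 0 < b) :
    Integrable fun w : Cn n => Real.exp (-(b * ‖w‖ ^ 2)) *
      (‖h w‖ * Real.exp (-(‖w‖ ^ 2 / (2 * t)))) := by
  have hp0 : 0 < p := by linarith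
  set ω : Cn n → ℝ := fun w => Real.exp (-(‖w‖ ^ 2 / (2 * t))) with hω
  have hωc : Continuous ω := by fun_prop
  have hum : AEStronglyMeasurable (fun w => ‖h w‖ * ω w) := hm.norm.mul hωc.aestronglyMeasurable
  have hu0 : ∀ w, 0 ≤ ‖h w‖ * ω w := fun w => mul_nonneg (norm_nonneg _) (Real.exp_pos _).le
  have hup : Integrable fun w => (‖h w‖ * ω w) ^ p := by
    refine ⟨(hum.aemeasurable.pow_const p).aestronglyMeasurable, ?_⟩
    rw [hasFiniteIntegral_iff_enorm]
    refine lt_of_eq_of_lt (lintegral_congr fun w => ?_) (lt_top_iff_ne_top.2 hN)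
    rw [Real.enorm_of_nonneg (Real.rpow_nonneg (hu0 w) p),
      ← ENNReal.ofReal_rpow_of_nonneg (hu0 w) hp0.le, ENNReal.ofReal_mul (norm_nonneg _),
      ofReal_norm]
  have hEc : Continuous fun w : Cn n => Real.exp (-(b * ‖w‖ ^ 2)) := by fun_prop
  refine Integrable.mono' ((integrable_exp_neg n hb).add hup)
    (hEc.aestronglyMeasurable.mul hum) (Eventually.of_forall fun w => ?_)
  have hE1 : Real.exp (-(b * ‖w‖ ^ 2)) ≤ 1 := Real.exp_le_one_iff.2 (by
    have : 0 ≤ b * ‖w‖ ^ 2 := by positivity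
    linarith)
  have hE0 := Real.exp_pos (-(b * ‖w‖ ^ 2))
  rw [Real.norm_of_nonneg (mul_nonneg hE0.le (hu0 w))]
  change _ ≤ Real.exp (-(b * ‖w‖ ^ 2)) + (‖h w‖ * ω w) ^ p
  rcases le_total (‖h w‖ * ω w) 1 with h1 | h1
  · have := Real.rpow_nonneg (hu0 w) p
    nlinarith
  · have := Real.self_le_rpow_of_one_le h1 hp.le
    nlinarith [hu0 w]

theorem integrable_exp_mul (hp : 1 < p) (ht : 0 < t) {h : Cn n → ℂ}
    (hm : AEStronglyMeasurable h) (hN : weightedLint p t h ≠ ∞) (a : ℝ) :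
    Integrable fun w : Cn n => Real.exp (a * ‖w‖) * (gaussian n t w * ‖h w‖) := by
  have hpi := Real.pi_pos
  have h1 := (integrable_weighted hp hm hN (b := 1 / (4 * t)) (by positivity)).const_mul
    (Real.exp (a ^ 2 * t) * (1 / (Real.pi * t) ^ n))
  have hc1 : Continuous fun w : Cn n => Real.exp (a * ‖w‖) := by fun_prop
  refine Integrable.mono' h1 (hc1.aestronglyMeasurable.mul
    ((continuous_gaussian n t).aestronglyMeasurable.mul hm.norm))
    (Eventually.of_forall fun w => ?_)
  have hg := (gaussian_pos n ht w).le
  rw [Real.norm_of_nonneg (by positivity), gaussian]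
  have key : Real.exp (a * ‖w‖) * Real.exp (-(‖w‖ ^ 2 / t)) ≤
      Real.exp (a ^ 2 * t) * (Real.exp (-(1 / (4 * t) * ‖w‖ ^ 2)) *
        Real.exp (-(‖w‖ ^ 2 / (2 * t)))) := by
    rw [← Real.exp_add, ← Real.exp_add, ← Real.exp_add, Real.exp_le_exp]
    have h2 : 0 ≤ (a * t - ‖w‖ / 2) ^ 2 / t := by positivity
    have h3 : (a * t - ‖w‖ / 2) ^ 2 / t = a ^ 2 * t - a * ‖w‖ + ‖w‖ ^ 2 / (4 * t) := by
      field_simp; ring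
    have h4 : ‖w‖ ^ 2 / t = 1 / (4 * t) * ‖w‖ ^ 2 + ‖w‖ ^ 2 / (2 * t) + ‖w‖ ^ 2 / (4 * t) := by
      field_simp; ring
    linarith
  calc Real.exp (a * ‖w‖) * (1 / (Real.pi * t) ^ n * Real.exp (-(‖w‖ ^ 2 / t)) * ‖h w‖)
      = (1 / (Real.pi * t) ^ n * ‖h w‖) *
          (Real.exp (a * ‖w‖) * Real.exp (-(‖w‖ ^ 2 / t))) := by ring
    _ ≤ (1 / (Real.pi * t) ^ n * ‖h w‖) * _ :=
        mul_le_mul_of_nonneg_left key (by positivity)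
    _ = _ := by ring

theorem norm_exp_inner_le (ht : 0 < t) (w z : Cn n) :
    ‖Complex.exp (inner ℂ w z / t)‖ ≤ Real.exp (‖z‖ / t * ‖w‖) := by
  rw [Complex.norm_exp, Real.exp_le_exp, Complex.div_ofReal_re]
  have h1 : (inner ℂ w z).re ≤ ‖w‖ * ‖z‖ :=
    (Complex.re_le_norm _).trans (norm_inner_le_norm w z)
  calc (inner ℂ w z).re / t ≤ ‖w‖ * ‖z‖ / t := by gcongr
    _ = _ := by ring

theorem continuous_exp_inner (t : ℝ) (z : Cn n) :
    Continuous fun w : Cn n => Complex.exp (inner ℂ w z / t) := by fun_prop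

theorem integrable_bergmanProj (hp : 1 < p) (ht : 0 < t) {h : Cn n → ℂ}
    (hm : AEStronglyMeasurable h) (hN : weightedLint p t h ≠ ∞) (z : Cn n) :
    Integrable fun w : Cn n => (gaussian n t w : ℂ) * (Complex.exp (inner ℂ w z / t) * h w) := by
  have hgc : Continuous fun w : Cn n => (gaussian n t w : ℂ) :=
    Complex.continuous_ofReal.comp (continuous_gaussian n t)
  refine Integrable.mono' (integrable_exp_mul hp ht hm hN (‖z‖ / t))
    (hgc.aestronglyMeasurable.mul ((continuous_exp_inner t z).aestronglyMeasurable.mul hm))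
    (Eventually.of_forall fun w => ?_)
  have hg := (gaussian_pos n ht w).le
  rw [norm_mul, norm_mul, Complex.norm_of_nonneg hg]
  calc _ = ‖Complex.exp (inner ℂ w z / t)‖ * (gaussian n t w * ‖h w‖) := by ring
    _ ≤ _ := mul_le_mul_of_nonneg_right (norm_exp_inner_le ht w z) (by positivity)

theorem differentiable_bergmanProj (hp : 1 < p) (ht : 0 < t) {h : Cn n → ℂ}
    (hm : AEStronglyMeasurable h) (hN : weightedLint p t h ≠ ∞) :
    Differentiable ℂ (bergmanProj t h) := by
  have hgc : Continuous fun w : Cn n => (gaussian n t w : ℂ) :=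
    Complex.continuous_ofReal.comp (continuous_gaussian n t)
  have heq : bergmanProj t h = fun z : Cn n => ∫ w, (gaussian n t w : ℂ) *
      (Complex.exp (inner ℂ w z / t) * h w) :=
    funext fun z => integral_gaussianMeasure n ht _
  rw [heq]
  intro z
  let D : Cn n → Cn n → (Cn n →L[ℂ] ℂ) := fun z w =>
    ((gaussian n t w : ℂ) * (Complex.exp (inner ℂ w z / t) * h w)) •
      ((1 / t : ℂ) • innerSL ℂ w)
  set R : ℝ := (‖z‖ + 1) / t with hR
  refine (hasFDerivAt_integral_of_dominated_of_fderiv_le (𝕜 := ℂ) (F' := D)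
    (s := Metric.ball z 1)
    (bound := fun w => 1 / t * (Real.exp ((R + 1) * ‖w‖) * (gaussian n t w * ‖h w‖)))
    (Metric.ball_mem_nhds z one_pos) ?_ ?_ ?_ ?_ ?_ ?_).differentiableAt
  · exact Eventually.of_forall fun z => (integrable_bergmanProj hp ht hm hN z).1
  · exact integrable_bergmanProj hp ht hm hN z
  · have hc : Continuous fun w : Cn n => (1 / t : ℂ) • innerSL ℂ w := by
      have h1 : Continuous fun w : Cn n => innerSL ℂ w := (innerSL ℂ (E := Cn n)).continuous
      exact h1.const_smul (1 / t : ℂ)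
    exact (integrable_bergmanProj hp ht hm hN z).1.smul hc.aestronglyMeasurable
  · refine Eventually.of_forall fun w y hy => ?_
    have hg := (gaussian_pos n ht w).le
    have hy1 : ‖y‖ ≤ ‖z‖ + 1 := by
      have h2 := norm_sub_norm_le y z
      rw [mem_ball_iff_norm] at hy
      linarith
    have hE : ‖Complex.exp (inner ℂ w y / t)‖ * ‖w‖ ≤ Real.exp ((R + 1) * ‖w‖) := by
      rw [add_mul, Real.exp_add, one_mul]
      refine mul_le_mul ((norm_exp_inner_le ht w y).trans (Real.exp_le_exp.2 ?_)) ?_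
        (norm_nonneg _) (Real.exp_pos _).le
      · rw [hR]; gcongr
      · linarith [Real.add_one_le_exp ‖w‖]
    simp only [D]
    rw [norm_smul, norm_smul, norm_mul, norm_mul, Complex.norm_of_nonneg hg, innerSL_apply_norm,
      norm_div, norm_one, Complex.norm_of_nonneg ht.le]
    calc _ = 1 / t * ((‖Complex.exp (inner ℂ w y / t)‖ * ‖w‖) * (gaussian n t w * ‖h w‖)) := by
          ring
      _ ≤ _ := by gcongr
  · exact (integrable_exp_mul hp ht hm hN (R + 1)).const_mul _
  · refine Eventually.of_forall fun w y _ => ?_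
    have h1 : HasFDerivAt (fun y : Cn n => inner ℂ w y / (t : ℂ)) ((1 / t : ℂ) • innerSL ℂ w) y := by
      have h2 := ((innerSL ℂ w).hasFDerivAt (x := y)).const_smul (1 / t : ℂ)
      refine h2.congr_of_eventuallyEq (Eventually.of_forall fun y => ?_)
      simp [div_eq_inv_mul]
    have h3 := ((h1.cexp.mul_const (h w)).const_mul (gaussian n t w : ℂ))
    refine h3.congr_fderiv ?_
    simp only [D, smul_smul]
    congr 1
    ring

theorem weightedLint_bergmanProj_le (hp : 1 < p) (ht : 0 < t) {h : Cn n → ℂ}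
    (hm : AEStronglyMeasurable h) :
    weightedLint p t (bergmanProj t h) ≤
      (ENNReal.ofReal (1 / (Real.pi * t) ^ n) *
        ∫⁻ w : Cn n, ENNReal.ofReal (Real.exp (-(‖w‖ ^ 2 / (2 * t))))) ^ p *
        weightedLint p t h := by
  have hp0 : 0 < p := by linarith
  have hpi := Real.pi_pos
  set c : ℝ≥0∞ := ENNReal.ofReal (1 / (Real.pi * t) ^ n) with hc
  set ω : Cn n → ℝ≥0∞ := fun w => ENNReal.ofReal (Real.exp (-(‖w‖ ^ 2 / (2 * t)))) with hω
  have hωm : Measurable ω := by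
    refine Measurable.ennreal_ofReal (Continuous.measurable ?_); fun_prop
  set K : ℝ≥0∞ := ∫⁻ w, ω w with hK
  set U : Cn n → ℝ≥0∞ := fun w => ‖h w‖ₑ * ω w with hU
  have hUm : AEMeasurable U := hm.enorm.mul hωm.aemeasurable
  have hωneg : ∀ w, ω (-w) = ω w := fun w => by simp [hω]
  have hωz : ∀ z, Measurable fun w : Cn n => ω (z - w) := fun z =>
    hωm.comp (measurable_id.const_sub z)
  have hKz : ∀ z, ∫⁻ w, ω (z - w) = K := fun z => by
    rw [hK, ← lintegral_sub_right_eq_self ω z]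
    exact lintegral_congr fun w => by rw [← hωneg, neg_sub]
  -- pointwise bound by a convolution with a Gaussian
  have hpt : ∀ z, ‖bergmanProj t h z‖ₑ * ω z ≤ c * ∫⁻ w, ω (z - w) * U w := fun z => by
    have h1 : ‖bergmanProj t h z‖ₑ ≤
        ∫⁻ w, ‖(gaussian n t w : ℂ) * (Complex.exp (inner ℂ w z / t) * h w)‖ₑ := by
      rw [bergmanProj, integral_gaussianMeasure n ht]
      exact enorm_integral_le_lintegral_enorm _
    refine (mul_le_mul_left h1 (ω z)).trans (le_of_eq ?_)
    rw [← lintegral_mul_const' _ _ ENNReal.ofReal_ne_top,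
      ← lintegral_const_mul' _ _ ENNReal.ofReal_ne_top]
    refine lintegral_congr fun w => ?_
    have h2 : gaussian n t w * ‖Complex.exp (inner ℂ w z / t)‖ *
        Real.exp (-(‖z‖ ^ 2 / (2 * t))) = 1 / (Real.pi * t) ^ n *
          (Real.exp (-(‖z - w‖ ^ 2 / (2 * t))) * Real.exp (-(‖w‖ ^ 2 / (2 * t)))) := by
      rw [gaussian, Complex.norm_exp, mul_assoc, mul_assoc, ← Real.exp_add, ← Real.exp_add,
        ← Real.exp_add, Complex.div_ofReal_re, @norm_sub_sq ℂ, ← inner_re_symm]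
      congr 2
      simp only [RCLike.re_to_complex]
      field_simp
      ring
    have h3 := congrArg ENNReal.ofReal h2
    have hg := (gaussian_pos n ht w).le
    rw [ENNReal.ofReal_mul (by positivity), ENNReal.ofReal_mul hg,
      ENNReal.ofReal_mul (by positivity), ENNReal.ofReal_mul (by positivity), ofReal_norm] at h3
    have h4 : ‖(gaussian n t w : ℂ)‖ₑ = ENNReal.ofReal (gaussian n t w) := by
      rw [← ofReal_norm, Complex.norm_of_nonneg hg]
    rw [enorm_mul, enorm_mul, h4]
    calc _ = ENNReal.ofReal (gaussian n t w) * ‖Complex.exp (inner ℂ w z / t)‖ₑ * ω z * ‖h w‖ₑ := by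
          ring
      _ = _ := by rw [h3]; simp only [hU, hω]; ring
  -- Hölder's inequality
  have hhol : ∀ z, (∫⁻ w, ω (z - w) * U w) ^ p ≤
      K ^ (p - 1) * ∫⁻ w, ω (z - w) * U w ^ p := fun z => by
    have hpq := Real.HolderConjugate.conjExponent hp
    set q := p.conjExponent with hq
    have hq0 : 0 < q := hpq.symm.pos
    have h1 := ENNReal.lintegral_mul_le_Lp_mul_Lq (volume : Measure (Cn n)) hpq.symm
      (f := fun w => ω (z - w) ^ (1 / q)) (g := fun w => ω (z - w) ^ (1 / p) * U w)
      ((hωz z).pow_const _).aemeasurable (((hωz z).pow_const _).aemeasurable.mul hUm)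
    have h2 : ∀ w, ((fun w => ω (z - w) ^ (1 / q)) * fun w => ω (z - w) ^ (1 / p) * U w) w =
        ω (z - w) * U w := fun w => by
      simp only [Pi.mul_apply]
      rw [← mul_assoc, ← ENNReal.rpow_add_of_nonneg _ _ (by positivity) (by positivity)]
      have : 1 / q + 1 / p = 1 := by
        have := hpq.symm.inv_add_inv_eq_one
        simpa [one_div] using this
      rw [this, ENNReal.rpow_one]
    have h3 : ∀ w, (ω (z - w) ^ (1 / q)) ^ q = ω (z - w) := fun w => by
      rw [← ENNReal.rpow_mul, one_div_mul_cancel hq0.ne', ENNReal.rpow_one]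
    have h4 : ∀ w, (ω (z - w) ^ (1 / p) * U w) ^ p = ω (z - w) * U w ^ p := fun w => by
      rw [ENNReal.mul_rpow_of_nonneg _ _ hp0.le, ← ENNReal.rpow_mul,
        one_div_mul_cancel hp0.ne', ENNReal.rpow_one]
    rw [lintegral_congr h2, lintegral_congr h3, lintegral_congr h4, hKz] at h1
    refine (ENNReal.rpow_le_rpow h1 hp0.le).trans (le_of_eq ?_)
    rw [ENNReal.mul_rpow_of_nonneg _ _ hp0.le, ← ENNReal.rpow_mul, ← ENNReal.rpow_mul,
      one_div_mul_cancel hp0.ne', ENNReal.rpow_one]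
    congr 2
    rw [hq, Real.conjExponent]
    have : p - 1 ≠ 0 := by linarith
    field_simp
  have hton : ∫⁻ z, ∫⁻ w, ω (z - w) * U w ^ p = K * ∫⁻ w, U w ^ p := by
    rw [lintegral_lintegral_swap]
    · have h1 : ∀ w, ∫⁻ z, ω (z - w) * U w ^ p = K * U w ^ p := fun w => by
        have h2 : ∫⁻ z, ω (z - w) * U w ^ p = (∫⁻ z, ω (z - w)) * U w ^ p :=
          lintegral_mul_const _ (hωm.comp (measurable_id.sub_const w))
        rw [h2, lintegral_sub_right_eq_self ω w]
      rw [lintegral_congr h1, lintegral_const_mul'' _ (hUm.pow_const p)]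
    · exact (hωm.comp (measurable_fst.sub measurable_snd)).aemeasurable.mul
        ((hUm.pow_const p).comp_snd)
  have hKp : K ^ (p - 1) * K = K ^ p := by
    nth_rewrite 2 [← ENNReal.rpow_one K]
    rw [← ENNReal.rpow_add_of_nonneg _ _ (by linarith) zero_le_one, sub_add_cancel]
  calc weightedLint p t (bergmanProj t h)
      ≤ ∫⁻ z, c ^ p * (K ^ (p - 1) * ∫⁻ w, ω (z - w) * U w ^ p) := by
        refine lintegral_mono fun z => ?_
        refine (ENNReal.rpow_le_rpow (hpt z) hp0.le).trans ?_
        rw [ENNReal.mul_rpow_of_nonneg _ _ hp0.le]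
        exact mul_le_mul_right (hhol z) _
    _ = c ^ p * (K ^ (p - 1) * (K * ∫⁻ w, U w ^ p)) := by
        have hmeas : AEMeasurable fun z : Cn n => ∫⁻ w, ω (z - w) * U w ^ p :=
          AEMeasurable.lintegral_prod_right' (f := fun q : Cn n × Cn n => ω (q.1 - q.2) * U q.2 ^ p)
            ((hωm.comp (measurable_fst.sub measurable_snd)).aemeasurable.mul
            ((hUm.pow_const p).comp_snd))
        rw [lintegral_const_mul'' _ (hmeas.const_mul _), lintegral_const_mul'' _ hmeas, hton]
    _ = (c * K) ^ p * weightedLint p t h := by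
        rw [← mul_assoc (K ^ (p - 1)), hKp, ENNReal.mul_rpow_of_nonneg _ _ hp0.le, mul_assoc]
        rfl

/-- Functions in `L^∞(ℂⁿ)`, up to almost everywhere equality. -/
abbrev LInfty (n : ℕ) : Type := Lp ℂ ∞ (volume : Measure (Cn n))

theorem weightedLint_mul_le (hp : 0 < p) (f : LInfty n) (g : Cn n → ℂ) :
    weightedLint p t (fun w => f w * g w) ≤ ‖f‖ₑ ^ p * weightedLint p t g := by
  unfold weightedLint
  rw [← lintegral_const_mul' _ _ (ENNReal.rpow_ne_top_of_nonneg hp.le enorm_ne_top)]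
  refine lintegral_mono_ae ?_
  have h1 := ae_le_eLpNormEssSup (f := f) (μ := volume)
  filter_upwards [h1] with w hw
  rw [← ENNReal.mul_rpow_of_nonneg _ _ hp.le, enorm_mul, ← mul_assoc]
  refine ENNReal.rpow_le_rpow ?_ hp.le
  rw [Lp.enorm_def, eLpNorm_exponent_top]
  gcongr

theorem FockSpace.aestronglyMeasurable_mul (f : LInfty n) (g : FockSpace n p t) :
    AEStronglyMeasurable (fun w => f w * g w) :=
  (Lp.aestronglyMeasurable f).mul g.continuous.aestronglyMeasurable

theorem FockSpace.weightedLint_mul_ne_top [Fact (1 < p)] [Fact (0 < t)] (f : LInfty n)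
    (g : FockSpace n p t) : weightedLint p t (fun w => f w * g w) ≠ ∞ := by
  have hp : 1 < p := Fact.out
  have hp0 : 0 < p := by linarith
  exact ne_top_of_le_ne_top (ENNReal.mul_ne_top
    (ENNReal.rpow_ne_top_of_nonneg hp0.le enorm_ne_top) g.weightedLint_ne_top)
    (weightedLint_mul_le hp0 f g)

/-- The bound for the operator norm in `weightedLint_toeplitz_le`. -/
def toeplitzBound (t : ℝ) (f : LInfty n) : ℝ≥0∞ :=
  ENNReal.ofReal (1 / (Real.pi * t) ^ n) *
    (∫⁻ w : Cn n, ENNReal.ofReal (Real.exp (-(‖w‖ ^ 2 / (2 * t))))) * ‖f‖ₑ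

theorem toeplitzBound_ne_top (ht : 0 < t) (f : LInfty n) : toeplitzBound t f ≠ ∞ := by
  refine ENNReal.mul_ne_top (ENNReal.mul_ne_top ENNReal.ofReal_ne_top ?_) enorm_ne_top
  have h1 := (integrable_exp_neg n (b := 1 / (2 * t)) (by positivity)).lintegral_lt_top.ne
  refine ne_of_eq_of_ne (lintegral_congr fun w => ?_) h1
  congr 3
  ring

theorem weightedLint_toeplitz_le [Fact (1 < p)] [Fact (0 < t)] (f : LInfty n)
    (g : FockSpace n p t) :
    weightedLint p t (bergmanProj t fun w => f w * g w) ≤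
      toeplitzBound t f ^ p * weightedLint p t g := by
  have hp : 1 < p := Fact.out
  have hp0 : 0 < p := by linarith
  refine (weightedLint_bergmanProj_le hp Fact.out (g.aestronglyMeasurable_mul f)).trans ?_
  rw [toeplitzBound, ENNReal.mul_rpow_of_nonneg _ ‖f‖ₑ hp0.le, mul_assoc]
  exact mul_le_mul_right (weightedLint_mul_le hp0 f g) _

/-- The Toeplitz operator `T_f^t g = P_t (f g)` on `F_t^p` with symbol `f ∈ L^∞(ℂⁿ)`. -/
def toeplitz [Fact (1 < p)] [Fact (0 < t)] (f : LInfty n) :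
    FockSpace n p t →L[ℂ] FockSpace n p t :=
  LinearMap.mkContinuous
    { toFun := fun g => FockSpace.mk' (bergmanProj t fun w => f w * g w)
        (differentiable_bergmanProj (p := p) Fact.out Fact.out (g.aestronglyMeasurable_mul f)
          (g.weightedLint_mul_ne_top f))
        (ne_top_of_le_ne_top (ENNReal.mul_ne_top
          (ENNReal.rpow_ne_top_of_nonneg (lt_trans one_pos Fact.out).le
            (toeplitzBound_ne_top Fact.out f))
          g.weightedLint_ne_top) (weightedLint_toeplitz_le f g))
      map_add' := fun g₁ g₂ => FockSpace.ext fun z => by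
        have hp : 1 < p := Fact.out
        have ht : 0 < t := Fact.out
        change bergmanProj t (fun w => f w * (g₁ w + g₂ w)) z =
          bergmanProj t (fun w => f w * g₁ w) z + bergmanProj t (fun w => f w * g₂ w) z
        simp only [bergmanProj, integral_gaussianMeasure n ht]
        rw [← integral_add
          (integrable_bergmanProj hp ht (g₁.aestronglyMeasurable_mul f)
            (g₁.weightedLint_mul_ne_top f) z)
          (integrable_bergmanProj hp ht (g₂.aestronglyMeasurable_mul f)
            (g₂.weightedLint_mul_ne_top f) z)]
        congr 1
        funext w
        ring
      map_smul' := fun c g => FockSpace.ext fun z => by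
        change bergmanProj t (fun w => f w * (c * g w)) z =
          c * bergmanProj t (fun w => f w * g w) z
        simp only [bergmanProj]
        rw [← integral_const_mul]
        congr 1
        funext w
        ring }
    (toeplitzBound t f).toReal fun g => by
      have hp : 1 < p := Fact.out
      have hp0 : 0 < p := by linarith
      have ht : 0 < t := Fact.out
      have hpi := Real.pi_pos
      have hB : 0 ≤ (toeplitzBound t f).toReal := ENNReal.toReal_nonneg
      have h1 := ENNReal.toReal_mono (ENNReal.mul_ne_top
          (ENNReal.rpow_ne_top_of_nonneg hp0.le (toeplitzBound_ne_top ht f))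
          g.weightedLint_ne_top) (weightedLint_toeplitz_le f g)
      rw [ENNReal.toReal_mul, ← ENNReal.toReal_rpow] at h1
      rw [FockSpace.norm_rpow, FockSpace.norm_rpow g]
      have h2 : (toeplitzBound t f).toReal =
          ((toeplitzBound t f).toReal ^ p) ^ (1 / p) := by
        rw [← Real.rpow_mul hB, mul_one_div_cancel hp0.ne', Real.rpow_one]
      rw [h2, ← Real.mul_rpow (Real.rpow_nonneg hB p) (by positivity)]
      refine Real.rpow_le_rpow (by positivity) ?_ (by positivity)
      rw [mul_left_comm]
      exact mul_le_mul_of_nonneg_left h1 (by positivity)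

theorem toeplitz_apply [Fact (1 < p)] [Fact (0 < t)] (f : LInfty n) (g : FockSpace n p t)
    (z : Cn n) : toeplitz f g z =
      ∫ w, Complex.exp (inner ℂ w z / t) * (f w * g w) ∂(gaussianMeasure n t) := rfl

/-! ### Toeplitz algebras -/

/-- `BUC(ℂⁿ)` as a subset of `L^∞(ℂⁿ)`: the classes of the bounded uniformly continuous functions. -/
def BUC (n : ℕ) : Set (LInfty n) :=
  {f | ∃ g : Cn n → ℂ, UniformContinuous g ∧ (∃ C, ∀ z, ‖g z‖ ≤ C) ∧ f =ᵐ[volume] g}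

section

variable (n p t) [Fact (1 < p)] [Fact (0 < t)]

/-- `T^{p,t}(S)`: the Banach algebra generated by the Toeplitz operators with symbols in `S`, that is
the smallest norm-closed subalgebra of `L(F_t^p)` containing them. -/
def toeplitzAlgebra (S : Set (LInfty n)) :
    NonUnitalSubalgebra ℂ (FockSpace n p t →L[ℂ] FockSpace n p t) :=
  (NonUnitalAlgebra.adjoin ℂ (toeplitz '' S)).topologicalClosure

/-- `T_lin^{p,t}(S)`: the norm-closed linear span of the Toeplitz operators with symbols in `S`. -/
def toeplitzLin (S : Set (LInfty n)) :
    Submodule ℂ (FockSpace n p t →L[ℂ] FockSpace n p t) :=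
  (Submodule.span ℂ (toeplitz '' S)).topologicalClosure

/-- `C₁`: the operators `A` for which `z ↦ W_z A W_{-z}` is continuous in operator norm. -/
def normContinuousOperators : Set (FockSpace n p t →L[ℂ] FockSpace n p t) :=
  {A | Continuous fun z : Cn n => translate z A}

end

end Fock

end

open Fock

noncomputable section

namespace Fock

section

variable {n : ℕ} {p t : ℝ}

/-! ### Gaussian integrals -/

/-! Everything is compared with C₁. Since α_z(A) = W_z A W_{-z} is an isometric action by algebra
automorphisms, C₁ is a norm-closed subalgebra. The first equalities reduce to two inclusions: every
Toeplitz operator with bounded symbol lies in C₁, and C₁ lies in the closed span of the Toeplitz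
operators with BUC symbols. That this span lies in the full algebra is immediate.

For the first inclusion (`toeplitz_mem_normContinuousOperators`) let P be the Bergman projection and
u_z(w) = exp((w·z̄ - z·w̄)/t), a unimodular function. As z → 0, W_z differs little in operator norm
from multiplication by u_z on F_t^p, and W_z P differs little from P u_z on L^p. After weighting by
exp(-|z|²/(2t)) the error kernels are dominated by convolution kernels of small L¹ norm, so Young's
inequality applies. Hence α_z(T_f) = W_z P f W_{-z} ≈ P u_z f u_{-z} = T_f. Multiplication operators
commute, so f needs no regularity.

For the second inclusion (`normContinuousOperators_subset_toeplitzLin`) the key identity is f_t * B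
= T_{B̃}, where B̃ is the Berezin transform of B, in BUC for B in C₁ (`conv_gaussian_eq_toeplitz`).
It follows from injectivity of the Berezin transform. To pass from f_t * C₁ to C₁, let a functional
φ kill the closed span and put b(z) = φ(α_z(A)). The semigroup law f_t * f_r = f_{t+r} gives ∫ f_s b
= 0 for all s > t. Up to normalization this integral is a Laplace transform in |z|², holomorphic in
1/s on the right half-plane, so it vanishes for every s > 0. Letting s → 0 yields φ(A) = b(0) = 0,
and Hahn-Banach concludes.

For the last two descriptions: g * A lies in C₁ for every bounded A, because translating it
translates g, and translation is continuous on L¹. With the approximate identity f_s, this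
characterizes C₁ by f_s * A → A. Cohen factorization for L¹ acting on C₁ (`exists_factorization`)
writes each element of C₁ as g * B. -/

theorem gaussian_eq_mul_exp (n : ℕ) (s : ℝ) (z : Cn n) :
    gaussian n s z = 1 / (Real.pi * s) ^ n * Real.exp (-(1 / s * ‖z‖ ^ 2)) := by
  rw [gaussian, one_div_mul_eq_div s (‖z‖ ^ 2)]

theorem ofReal_gaussian (n : ℕ) (s : ℝ) (z : Cn n) :
    (gaussian n s z : ℂ) = 1 / (Real.pi * s : ℂ) ^ n * Complex.exp (-(inner ℂ z z / s)) := by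
  rw [inner_self_eq_norm_sq_to_K, gaussian]
  push_cast
  rfl

theorem integrable_gaussian (n : ℕ) {s : ℝ} (hs : 0 < s) : Integrable (gaussian n s) := by
  have h := (integrable_exp_neg n (b := 1 / s) (by positivity)).const_mul (1 / (Real.pi * s) ^ n)
  exact h.congr (Eventually.of_forall fun z => (gaussian_eq_mul_exp n s z).symm)

theorem integral_gaussian (n : ℕ) {s : ℝ} (hs : 0 < s) : ∫ z, gaussian n s z = 1 := by
  have hpi := Real.pi_pos
  have h := GaussianFourier.integral_rexp_neg_mul_sq_norm (V := Cn n) (b := 1 / s) (by positivity)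
  have hf : Module.finrank ℝ (Cn n) = 2 * n := by
    rw [finrank_real_of_complex, finrank_euclideanSpace_fin]
  simp_rw [gaussian_eq_mul_exp, integral_const_mul, ← neg_mul]
  rw [h, hf]
  push_cast
  rw [mul_div_cancel_left₀ _ (two_ne_zero), Real.rpow_natCast, div_div_eq_mul_div, div_one,
    one_div_mul_cancel (by positivity)]

theorem integrable_ofReal_gaussian (n : ℕ) {s : ℝ} (hs : 0 < s) :
    Integrable fun z : Cn n => (gaussian n s z : ℂ) :=
  (integrable_gaussian n hs).ofReal

theorem integral_norm_gaussian (n : ℕ) {s : ℝ} (hs : 0 < s) :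
    ∫ z : Cn n, ‖(gaussian n s z : ℂ)‖ = 1 := by
  rw [← integral_gaussian n hs]
  exact integral_congr_ae (Eventually.of_forall fun z =>
    Complex.norm_of_nonneg (gaussian_pos n hs z).le)

/-! ### Mean value property and reproducing formula -/

/-- Multiplication by a unimodular number as a real linear isometry of `ℂⁿ`. -/
def rotation (n : ℕ) (c : ℂ) (hc : ‖c‖ = 1) : Cn n ≃ₗᵢ[ℝ] Cn n where
  toLinearEquiv := DistribMulAction.toLinearEquiv ℝ (Cn n)
    (Units.mk0 c (norm_ne_zero_iff.1 (by rw [hc]; exact one_ne_zero)))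
  norm_map' w := by
    change ‖c • w‖ = ‖w‖
    rw [norm_smul, hc, one_mul]

theorem integral_comp_unimodular_smul (c : ℂ) (hc : ‖c‖ = 1) (h : Cn n → ℂ) :
    ∫ w, h (c • w) = ∫ w, h w :=
  (LinearIsometryEquiv.measurePreserving (rotation n c hc)).integral_comp
    (rotation n c hc).toHomeomorph.measurableEmbedding h

theorem integrable_comp_unimodular_smul (c : ℂ) (hc : ‖c‖ = 1) {h : Cn n → ℂ}
    (hh : Integrable h) : Integrable fun w => h (c • w) :=
  (LinearIsometryEquiv.measurePreserving (rotation n c hc)).integrable_comp_of_integrable hh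

/-- The Gaussian is invariant under w ↦ e^{iθ}w, so the integral may be averaged over θ. By Fubini
the circle average falls on g, where the one-variable mean value property on the line ℂw gives g(0).
-/
theorem integral_gaussian_mul_of_differentiable {s : ℝ} (hs : 0 < s) {g : Cn n → ℂ}
    (hg : Differentiable ℂ g) (hi : Integrable fun w => (gaussian n s w : ℂ) * g w) :
    ∫ w, (gaussian n s w : ℂ) * g w = g 0 := by
  have hcirc : ∀ θ : ℝ, ‖circleMap 0 1 θ‖ = 1 := fun θ => by simp [norm_circleMap_zero]
  have hrot : ∀ (θ : ℝ) (w : Cn n), gaussian n s (circleMap 0 1 θ • w) = gaussian n s w :=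
    fun θ w => by simp only [gaussian, norm_smul, hcirc, one_mul]
  have hmean : ∀ w : Cn n, ∫ θ in (0 : ℝ)..2 * Real.pi, g (circleMap 0 1 θ • w) =
      2 * Real.pi * g 0 := fun w => by
    have hd : Differentiable ℂ fun l : ℂ => g (l • w) :=
      hg.comp (differentiable_id.smul_const w)
    have h := hd.diffContOnCl (s := Metric.ball 0 |1|) |>.circleAverage
    rw [Real.circleAverage_def, zero_smul] at h
    rw [← h, Complex.real_smul]
    push_cast
    have : (Real.pi : ℂ) ≠ 0 := by exact_mod_cast Real.pi_ne_zero
    field_simp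
  let G : ℝ → Cn n → ℂ := fun θ w => (gaussian n s w : ℂ) * g (circleMap 0 1 θ • w)
  have hGrot : ∀ θ w, G θ w = (fun w => (gaussian n s w : ℂ) * g w) (circleMap 0 1 θ • w) :=
    fun θ w => by simp only [G, hrot]
  have hGi : ∀ θ, ∫ w, G θ w = ∫ w, (gaussian n s w : ℂ) * g w := fun θ => by
    simp_rw [hGrot]
    exact integral_comp_unimodular_smul _ (hcirc θ) fun w => (gaussian n s w : ℂ) * g w
  have hGn : ∀ θ, ∫ w, ‖G θ w‖ = ∫ w, ‖(gaussian n s w : ℂ) * g w‖ := fun θ => by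
    simp_rw [hGrot]
    exact (LinearIsometryEquiv.measurePreserving (rotation n _ (hcirc θ))).integral_comp
      (rotation n _ (hcirc θ)).toHomeomorph.measurableEmbedding
      fun w => ‖(gaussian n s w : ℂ) * g w‖
  have hGc : Continuous (Function.uncurry G) := by
    have h1 := continuous_gaussian n s
    have h2 := hg.continuous
    have h3 : Continuous fun q : ℝ × Cn n => circleMap 0 1 q.1 • q.2 :=
      ((continuous_circleMap 0 1).comp continuous_fst).smul continuous_snd
    exact (Complex.continuous_ofReal.comp (h1.comp continuous_snd)).mul (h2.comp h3)
  -- All rotated slices have the same L¹ norm, so the outer integral is that of a constant over a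
  -- bounded interval.
  have hint : Integrable (Function.uncurry G)
      ((volume.restrict (Set.uIoc 0 (2 * Real.pi))).prod volume) := by
    refine (integrable_prod_iff hGc.aestronglyMeasurable).2 ⟨Eventually.of_forall fun θ => ?_, ?_⟩
    · change Integrable (G θ)
      exact (integrable_comp_unimodular_smul _ (hcirc θ) hi).congr
        (Eventually.of_forall fun w => (hGrot θ w).symm)
    · simp only [Function.uncurry, hGn]
      have : IsFiniteMeasure ((volume : Measure ℝ).restrict (Set.uIoc 0 (2 * Real.pi))) := by
        rw [Set.uIoc]; infer_instance
      exact integrable_const _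
  have hswap := intervalIntegral_integral_swap hint
  simp_rw [hGi] at hswap
  simp only [G, intervalIntegral.integral_const_mul, hmean] at hswap
  rw [intervalIntegral.integral_const, integral_mul_const, integral_complex_ofReal,
    integral_gaussian n hs] at hswap
  have hpi : (2 * Real.pi : ℂ) ≠ 0 := by
    simp [Real.pi_ne_zero]
  rw [sub_zero, Complex.real_smul] at hswap
  push_cast at hswap
  rw [one_mul] at hswap
  exact mul_left_cancel₀ hpi hswap

variable [Fact (1 < p)] [Fact (0 < t)]

/-- The mean value formula at the origin, applied to W_{-z} g, is the reproducing formula at z after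
the substitution w ↦ w - z. -/
theorem FockSpace.bergmanProj_eq (g : FockSpace n p t) (z : Cn n) : bergmanProj t g z = g z := by
  have hp : 1 < p := Fact.out
  have ht : 0 < t := Fact.out
  have htc : (t : ℂ) ≠ 0 := by exact_mod_cast ht.ne'
  have h1 := integral_gaussian_mul_of_differentiable ht (weyl (-z) g).2.1 (by
    have := integrable_bergmanProj hp ht (weyl (-z) g).continuous.aestronglyMeasurable
      (weyl (-z) g).weightedLint_ne_top 0
    simpa using this)
  have h2 : (weyl (-z) g).1 0 = normalizedKernel t (-z) 0 * g z := by
    rw [weyl_apply, sub_neg_eq_add, zero_add]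
  have hne : normalizedKernel t (-z) 0 ≠ 0 := Complex.exp_ne_zero _
  rw [h2] at h1
  rw [← mul_right_inj' hne, ← h1, bergmanProj, integral_gaussianMeasure n ht,
    ← integral_const_mul,
    ← integral_sub_right_eq_self (fun w => (gaussian n t w : ℂ) * (weyl (-z) g).1 w) z]
  refine integral_congr_ae (Eventually.of_forall fun w => ?_)
  change normalizedKernel t (-z) 0 * ((gaussian n t w : ℂ) * (Complex.exp (inner ℂ w z / t) * g w)) =
    (gaussian n t (w - z) : ℂ) * weyl (-z) g (w - z)
  rw [weyl_apply, sub_neg_eq_add, sub_add_cancel, ofReal_gaussian, ofReal_gaussian,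
    normalizedKernel, normalizedKernel]
  have h3 : ((‖z‖ : ℂ)) ^ 2 = inner ℂ z z := (inner_self_eq_norm_sq_to_K z).symm
  have key : Complex.exp (inner ℂ (-z) 0 / t - (‖-z‖ ^ 2 / (2 * t) : ℝ)) *
      (Complex.exp (-(inner ℂ w w / t)) * Complex.exp (inner ℂ w z / t)) =
      Complex.exp (-(inner ℂ (w - z) (w - z) / t)) *
      Complex.exp (inner ℂ (-z) (w - z) / t - (‖-z‖ ^ 2 / (2 * t) : ℝ)) := by
    rw [← Complex.exp_add, ← Complex.exp_add, ← Complex.exp_add]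
    congr 1
    push_cast
    rw [norm_neg, h3]
    simp only [inner_sub_left, inner_sub_right, inner_neg_left, inner_zero_right]
    field_simp
    ring
  linear_combination (1 / (Real.pi * t : ℂ) ^ n * g w) * key

end

section

variable {n : ℕ} {p t : ℝ}

/-! ### Weighted norm estimates -/

/-- The weight `exp (-|z|² / (2t))`. -/
def weight (t : ℝ) (z : Cn n) : ℝ≥0∞ := ENNReal.ofReal (Real.exp (-(‖z‖ ^ 2 / (2 * t))))

theorem measurable_weight (n : ℕ) (t : ℝ) : Measurable (weight t : Cn n → ℝ≥0∞) := by
  refine Measurable.ennreal_ofReal (Continuous.measurable ?_); fun_prop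

theorem lintegral_weight_rpow_ne_top (n : ℕ) (ht : 0 < t) {q : ℝ} (hq : 0 < q) :
    ∫⁻ z : Cn n, weight t z ^ q ≠ ∞ := by
  have h1 := (integrable_exp_neg n (b := q / (2 * t)) (by positivity)).lintegral_lt_top.ne
  refine ne_of_eq_of_ne (lintegral_congr fun w => ?_) h1
  rw [weight, ENNReal.ofReal_rpow_of_pos (Real.exp_pos _), ← Real.exp_mul]
  congr 2
  ring

theorem eLpNorm_le_mul_of_weightedLint_le (hp : 0 < p) (ht : 0 < t) {F h : Cn n → ℂ} {K : ℝ≥0∞}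
    (hF : weightedLint p t F ≤ K ^ p * weightedLint p t h) :
    eLpNorm F (ENNReal.ofReal p) (gaussianMeasure n (2 * t / p)) ≤
      K * eLpNorm h (ENNReal.ofReal p) (gaussianMeasure n (2 * t / p)) := by
  have h1 : (0 : ℝ) ≤ 1 / p := by positivity
  have h2 : K = (K ^ p) ^ (1 / p) := by
    rw [← ENNReal.rpow_mul, mul_one_div_cancel hp.ne', ENNReal.rpow_one]
  rw [eLpNorm_eq hp ht, eLpNorm_eq hp ht, h2, ← ENNReal.mul_rpow_of_nonneg _ _ h1]
  refine ENNReal.rpow_le_rpow ?_ h1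
  rw [mul_left_comm]
  exact mul_le_mul_right hF _

/-- Young's inequality for a kernel dominated by a convolution kernel. -/
theorem eLpNorm_le_of_le_convolution (hp : 1 < p) (ht : 0 < t) {F h : Cn n → ℂ}
    (hm : AEStronglyMeasurable h) {H : Cn n → ℝ≥0∞} (hH : Measurable H)
    (hpt : ∀ z, ‖F z‖ₑ * weight t z ≤ ∫⁻ w, H (z - w) * (‖h w‖ₑ * weight t w)) :
    eLpNorm F (ENNReal.ofReal p) (gaussianMeasure n (2 * t / p)) ≤
      (∫⁻ z, H z) * eLpNorm h (ENNReal.ofReal p) (gaussianMeasure n (2 * t / p)) := by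
  have hp0 : 0 < p := by linarith
  refine eLpNorm_le_mul_of_weightedLint_le hp0 ht ?_
  set K : ℝ≥0∞ := ∫⁻ w, H w with hK
  set U : Cn n → ℝ≥0∞ := fun w => ‖h w‖ₑ * weight t w with hU
  have hUm : AEMeasurable U := hm.enorm.mul (measurable_weight n t).aemeasurable
  have hHz : ∀ z, Measurable fun w : Cn n => H (z - w) := fun z =>
    hH.comp (measurable_id.const_sub z)
  have hKz : ∀ z, ∫⁻ w, H (z - w) = K := fun z => lintegral_sub_left_eq_self H z
  -- Hölder with the splitting H = H^{1/q} H^{1/p}, where q is conjugate to p. Tonelli below then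
  -- supplies the remaining factor K.
  have hhol : ∀ z, (∫⁻ w, H (z - w) * U w) ^ p ≤
      K ^ (p - 1) * ∫⁻ w, H (z - w) * U w ^ p := fun z => by
    have hpq := Real.HolderConjugate.conjExponent hp
    set q := p.conjExponent with hq
    have hq0 : 0 < q := hpq.symm.pos
    have h1 := ENNReal.lintegral_mul_le_Lp_mul_Lq (volume : Measure (Cn n)) hpq.symm
      (f := fun w => H (z - w) ^ (1 / q)) (g := fun w => H (z - w) ^ (1 / p) * U w)
      ((hHz z).pow_const _).aemeasurable (((hHz z).pow_const _).aemeasurable.mul hUm)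
    have h2 : ∀ w, ((fun w => H (z - w) ^ (1 / q)) * fun w => H (z - w) ^ (1 / p) * U w) w =
        H (z - w) * U w := fun w => by
      simp only [Pi.mul_apply]
      rw [← mul_assoc, ← ENNReal.rpow_add_of_nonneg _ _ (by positivity) (by positivity)]
      have : 1 / q + 1 / p = 1 := by
        have := hpq.symm.inv_add_inv_eq_one
        simpa [one_div] using this
      rw [this, ENNReal.rpow_one]
    have h3 : ∀ w, (H (z - w) ^ (1 / q)) ^ q = H (z - w) := fun w => by
      rw [← ENNReal.rpow_mul, one_div_mul_cancel hq0.ne', ENNReal.rpow_one]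
    have h4 : ∀ w, (H (z - w) ^ (1 / p) * U w) ^ p = H (z - w) * U w ^ p := fun w => by
      rw [ENNReal.mul_rpow_of_nonneg _ _ hp0.le, ← ENNReal.rpow_mul,
        one_div_mul_cancel hp0.ne', ENNReal.rpow_one]
    rw [lintegral_congr h2, lintegral_congr h3, lintegral_congr h4, hKz] at h1
    refine (ENNReal.rpow_le_rpow h1 hp0.le).trans (le_of_eq ?_)
    rw [ENNReal.mul_rpow_of_nonneg _ _ hp0.le, ← ENNReal.rpow_mul, ← ENNReal.rpow_mul,
      one_div_mul_cancel hp0.ne', ENNReal.rpow_one]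
    congr 2
    rw [hq, Real.conjExponent]
    have : p - 1 ≠ 0 := by linarith
    field_simp
  have hHm : AEMeasurable fun q : Cn n × Cn n => H (q.1 - q.2) * U q.2 ^ p :=
    (hH.comp (measurable_fst.sub measurable_snd)).aemeasurable.mul ((hUm.pow_const p).comp_snd)
  have hton : ∫⁻ z, ∫⁻ w, H (z - w) * U w ^ p = K * ∫⁻ w, U w ^ p := by
    rw [lintegral_lintegral_swap hHm]
    have h1 : ∀ w, ∫⁻ z, H (z - w) * U w ^ p = K * U w ^ p := fun w => by
      have h2 : ∫⁻ z, H (z - w) * U w ^ p = (∫⁻ z, H (z - w)) * U w ^ p :=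
        lintegral_mul_const _ (hH.comp (measurable_id.sub_const w))
      rw [h2, lintegral_sub_right_eq_self H w]
    rw [lintegral_congr h1, lintegral_const_mul'' _ (hUm.pow_const p)]
  have hKp : K ^ (p - 1) * K = K ^ p := by
    nth_rewrite 2 [← ENNReal.rpow_one K]
    rw [← ENNReal.rpow_add_of_nonneg _ _ (by linarith) zero_le_one, sub_add_cancel]
  calc weightedLint p t F
      ≤ ∫⁻ z, K ^ (p - 1) * ∫⁻ w, H (z - w) * U w ^ p :=
        lintegral_mono fun z => (ENNReal.rpow_le_rpow (hpt z) hp0.le).trans (hhol z)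
    _ = K ^ (p - 1) * (K * ∫⁻ w, U w ^ p) := by
        rw [lintegral_const_mul'' _ (AEMeasurable.lintegral_prod_right' hHm), hton]
    _ = K ^ p * weightedLint p t h := by
        rw [← mul_assoc, hKp]
        rfl

/-! ### The Bergman projection on L^p and completeness of the Fock space. -/

theorem gaussianMeasure_absolutelyContinuous (n : ℕ) (t : ℝ) :
    gaussianMeasure n t ≪ (volume : Measure (Cn n)) :=
  withDensity_absolutelyContinuous _ _

theorem aestronglyMeasurable_gaussianMeasure_iff (ht : 0 < t) {h : Cn n → ℂ} :
    AEStronglyMeasurable h (gaussianMeasure n t) ↔ AEStronglyMeasurable h volume :=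
  ⟨fun H => H.mono_ac (volume_absolutelyContinuous n ht),
    fun H => H.mono_ac (gaussianMeasure_absolutelyContinuous n t)⟩

theorem FockSpace.sub_apply (f g : FockSpace n p t) (z : Cn n) : (f - g) z = f z - g z := rfl

theorem FockSpace.add_apply (f g : FockSpace n p t) (z : Cn n) : (f + g) z = f z + g z := rfl

theorem FockSpace.smul_apply (c : ℂ) (g : FockSpace n p t) (z : Cn n) : (c • g) z = c * g z := rfl

/-- The bound `c ∫ exp (-|w|²/(2t)) dw` for the norm of the Bergman projection. -/
def bergmanBound (n : ℕ) (t : ℝ) : ℝ≥0∞ :=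
  ENNReal.ofReal (1 / (Real.pi * t) ^ n) *
    ∫⁻ w : Cn n, ENNReal.ofReal (Real.exp (-(‖w‖ ^ 2 / (2 * t))))

theorem bergmanBound_ne_top (n : ℕ) (ht : 0 < t) : bergmanBound n t ≠ ∞ := by
  refine ENNReal.mul_ne_top ENNReal.ofReal_ne_top ?_
  simpa [weight] using lintegral_weight_rpow_ne_top n ht one_pos

variable [Fact (1 < p)] [Fact (0 < t)]

theorem _root_.MeasureTheory.MemLp.aestronglyMeasurable_volume {h : Cn n → ℂ}
    (hh : MemLp h (ENNReal.ofReal p) (gaussianMeasure n (2 * t / p))) :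
    AEStronglyMeasurable h volume := by
  have hp : 1 < p := Fact.out
  have ht : 0 < t := Fact.out
  exact (aestronglyMeasurable_gaussianMeasure_iff (by positivity)).1 hh.1

theorem _root_.MeasureTheory.MemLp.weightedLint_ne_top {h : Cn n → ℂ}
    (hh : MemLp h (ENNReal.ofReal p) (gaussianMeasure n (2 * t / p))) :
    weightedLint p t h ≠ ∞ := by
  have hp : 1 < p := Fact.out
  exact (eLpNorm_ne_top_iff (by linarith) Fact.out h).1 hh.2.ne

theorem FockSpace.enorm_eq (f : FockSpace n p t) :
    ‖f‖ₑ = eLpNorm f (ENNReal.ofReal p) (gaussianMeasure n (2 * t / p)) := by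
  rw [← ofReal_norm, FockSpace.norm_def, ENNReal.ofReal_toReal f.memLp.2.ne]

theorem weightedLint_bergmanProj_ne_top {h : Cn n → ℂ}
    (hh : MemLp h (ENNReal.ofReal p) (gaussianMeasure n (2 * t / p))) :
    weightedLint p t (bergmanProj t h) ≠ ∞ :=
  ne_top_of_le_ne_top (ENNReal.mul_ne_top
    (ENNReal.rpow_ne_top_of_nonneg (lt_trans one_pos Fact.out).le (bergmanBound_ne_top n Fact.out))
    hh.weightedLint_ne_top)
    (weightedLint_bergmanProj_le Fact.out Fact.out hh.aestronglyMeasurable_volume)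

/-- The Bergman projection of a function in `L^p(μ_{2t/p})`. -/
def bergman (h : Cn n → ℂ) (hh : MemLp h (ENNReal.ofReal p) (gaussianMeasure n (2 * t / p))) :
    FockSpace n p t :=
  FockSpace.mk' (bergmanProj t h)
    (differentiable_bergmanProj Fact.out Fact.out hh.aestronglyMeasurable_volume
      hh.weightedLint_ne_top)
    (weightedLint_bergmanProj_ne_top hh)

theorem bergman_apply (h : Cn n → ℂ)
    (hh : MemLp h (ENNReal.ofReal p) (gaussianMeasure n (2 * t / p))) (z : Cn n) :
    bergman h hh z = bergmanProj t h z := rfl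

theorem enorm_bergman_le (h : Cn n → ℂ)
    (hh : MemLp h (ENNReal.ofReal p) (gaussianMeasure n (2 * t / p))) :
    ‖bergman h hh‖ₑ ≤ bergmanBound n t *
      eLpNorm h (ENNReal.ofReal p) (gaussianMeasure n (2 * t / p)) := by
  rw [FockSpace.enorm_eq]
  exact eLpNorm_le_mul_of_weightedLint_le (lt_trans one_pos Fact.out) Fact.out
    (weightedLint_bergmanProj_le Fact.out Fact.out hh.aestronglyMeasurable_volume)

theorem bergman_sub {h₁ h₂ : Cn n → ℂ}
    (hh₁ : MemLp h₁ (ENNReal.ofReal p) (gaussianMeasure n (2 * t / p)))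
    (hh₂ : MemLp h₂ (ENNReal.ofReal p) (gaussianMeasure n (2 * t / p))) :
    bergman (h₁ - h₂) (hh₁.sub hh₂) = bergman h₁ hh₁ - bergman h₂ hh₂ := by
  refine FockSpace.ext fun z => ?_
  rw [FockSpace.sub_apply, bergman_apply, bergman_apply, bergman_apply]
  simp only [bergmanProj, integral_gaussianMeasure n (Fact.out : 0 < t)]
  rw [← integral_sub
    (integrable_bergmanProj Fact.out Fact.out hh₁.aestronglyMeasurable_volume
      hh₁.weightedLint_ne_top z)
    (integrable_bergmanProj Fact.out Fact.out hh₂.aestronglyMeasurable_volume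
      hh₂.weightedLint_ne_top z)]
  refine integral_congr_ae (Eventually.of_forall fun w => ?_)
  simp only [Pi.sub_apply]
  ring

theorem bergman_coe (g : FockSpace n p t) : bergman g g.memLp = g :=
  FockSpace.ext fun z => g.bergmanProj_eq z

/-- As P g = g, the difference is P(g - h): an L^p approximation of g by arbitrary functions becomes
one inside the Fock space. -/
theorem FockSpace.enorm_sub_bergman_le (g : FockSpace n p t) (h : Cn n → ℂ)
    (hh : MemLp h (ENNReal.ofReal p) (gaussianMeasure n (2 * t / p))) :
    ‖g - bergman h hh‖ₑ ≤ bergmanBound n t *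
      eLpNorm ((g : Cn n → ℂ) - h) (ENNReal.ofReal p) (gaussianMeasure n (2 * t / p)) := by
  nth_rewrite 1 [← bergman_coe g]
  rw [← bergman_sub]
  exact enorm_bergman_le _ _

/-- A Cauchy sequence has an L^p limit h. Since P is bounded and fixes the sequence, it converges to
P h, which is already an entire function in the space. -/
instance : CompleteSpace (FockSpace n p t) := by
  have hp : 1 < p := Fact.out
  have : Fact ((1 : ℝ≥0∞) ≤ ENNReal.ofReal p) := ⟨by simpa using hp.le⟩
  refine Metric.complete_of_cauchySeq_tendsto fun u hu => ?_
  let v : ℕ → Lp ℂ (ENNReal.ofReal p) (gaussianMeasure n (2 * t / p)) := fun k =>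
    (u k).memLp.toLp (u k)
  have hdist : ∀ j k, dist (v j) (v k) = dist (u j) (u k) := fun j k => by
    rw [dist_eq_norm, dist_eq_norm, ← MemLp.toLp_sub, Lp.norm_toLp]
    rfl
  have hv : CauchySeq v := by
    rw [Metric.cauchySeq_iff] at hu ⊢
    simpa only [hdist] using hu
  obtain ⟨h, hh⟩ := cauchySeq_tendsto_of_complete hv
  refine ⟨bergman h (Lp.memLp h), ?_⟩
  rw [tendsto_iff_edist_tendsto_0] at hh ⊢
  have hB := ENNReal.Tendsto.const_mul (a := bergmanBound n t) hh
    (Or.inr (bergmanBound_ne_top n Fact.out))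
  rw [mul_zero] at hB
  refine tendsto_of_tendsto_of_tendsto_of_le_of_le tendsto_const_nhds hB (fun _ => zero_le) fun k => ?_
  change edist (u k) _ ≤ bergmanBound n t * edist (v k) h
  rw [edist_eq_enorm_sub]
  refine (FockSpace.enorm_sub_bergman_le _ _ _).trans (le_of_eq ?_)
  rw [Lp.edist_def]
  congr 1
  refine eLpNorm_congr_ae ?_
  filter_upwards [(u k).memLp.coeFn_toLp] with w hw
  simp only [Pi.sub_apply, v, hw]

/-! ### Point evaluations -/

/-- At the origin the reproducing kernel is 1 and the Gaussian is, up to a constant, the square of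
the weight. Hölder pairs one weight in L^q with the weighted function in L^p. -/
theorem exists_norm_apply_zero_le (n : ℕ) (p t : ℝ) [Fact (1 < p)] [Fact (0 < t)] :
    ∃ C : ℝ, 0 ≤ C ∧ ∀ g : FockSpace n p t, ‖g 0‖ ≤ C * ‖g‖ := by
  have hp : 1 < p := Fact.out
  have ht : 0 < t := Fact.out
  have hp0 : 0 < p := by linarith
  have hpi := Real.pi_pos
  have hpq := Real.HolderConjugate.conjExponent hp
  set q := p.conjExponent
  set c : ℝ≥0∞ := ENNReal.ofReal (1 / (Real.pi * t) ^ n)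
  set d : ℝ≥0∞ := ENNReal.ofReal (1 / (Real.pi * (2 * t / p)) ^ n)
  have hd : d ≠ 0 := by simp only [d, ne_eq, ENNReal.ofReal_eq_zero, not_le]; positivity
  have hd1 : d ^ (1 / p) ≠ 0 := by
    rw [ne_eq, ENNReal.rpow_eq_zero_iff_of_pos (by positivity)]; exact hd
  have hd2 : d ^ (1 / p) ≠ ∞ := ENNReal.rpow_ne_top_of_nonneg (by positivity) ENNReal.ofReal_ne_top
  -- The constant c normalizes the Gaussian in the reproducing formula; dividing by d^{1/p} converts
  -- the weighted L^p integral into the norm of the Fock space.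
  set K : ℝ≥0∞ := c * ((∫⁻ w : Cn n, weight t w ^ q) ^ (1 / q) * (d ^ (1 / p))⁻¹)
  have hK : K ≠ ∞ := ENNReal.mul_ne_top ENNReal.ofReal_ne_top (ENNReal.mul_ne_top
    (ENNReal.rpow_ne_top_of_nonneg hpq.symm.one_div_nonneg
      (lintegral_weight_rpow_ne_top n ht hpq.symm.pos)) (ENNReal.inv_ne_top.2 hd1))
  refine ⟨K.toReal, ENNReal.toReal_nonneg, fun g => ?_⟩
  have key : ‖g 0‖ₑ ≤ K * ‖g‖ₑ := by
    rw [← g.bergmanProj_eq 0, bergmanProj, integral_gaussianMeasure n ht]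
    refine (enorm_integral_le_lintegral_enorm _).trans ?_
    have h1 : ∀ w : Cn n, ‖(gaussian n t w : ℂ) * (Complex.exp (inner ℂ w 0 / t) * g w)‖ₑ =
        c * (weight t w * (‖g w‖ₑ * weight t w)) := fun w => by
      rw [inner_zero_right, zero_div, Complex.exp_zero, one_mul, enorm_mul, ← ofReal_norm,
        Complex.norm_of_nonneg (gaussian_pos n ht w).le, gaussian, mul_left_comm (weight t w),
        weight, ← ENNReal.ofReal_mul (Real.exp_pos _).le, ← Real.exp_add,
        ENNReal.ofReal_mul (by positivity), mul_assoc, mul_comm ‖g w‖ₑ]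
      congr 4
      field_simp
      ring
    have hwm := (measurable_weight n t).aemeasurable (μ := volume)
    have h2 := ENNReal.lintegral_mul_le_Lp_mul_Lq (volume : Measure (Cn n)) hpq.symm
      hwm (g.continuous.measurable.enorm.aemeasurable.mul hwm)
    rw [lintegral_congr h1, lintegral_const_mul' _ _ ENNReal.ofReal_ne_top, FockSpace.enorm_eq,
      eLpNorm_eq hp0 ht, ENNReal.mul_rpow_of_nonneg _ _ (by positivity), mul_assoc, mul_assoc,
      ← mul_assoc (d ^ (1 / p))⁻¹, ENNReal.inv_mul_cancel hd1 hd2, one_mul]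
    exact mul_le_mul_right h2 _
  have h3 := ENNReal.toReal_mono (ENNReal.mul_ne_top hK enorm_ne_top) key
  rwa [ENNReal.toReal_mul, toReal_enorm, toReal_enorm] at h3

/-- The norm of the evaluation at `0`, up to a constant. -/
def evalBound (n : ℕ) (p t : ℝ) [Fact (1 < p)] [Fact (0 < t)] : ℝ :=
  (exists_norm_apply_zero_le n p t).choose

/-- The isometry W_{-z} moves z to the origin, at the price of the value of the normalized kernel
there. -/
theorem FockSpace.norm_apply_le (g : FockSpace n p t) (z : Cn n) :
    ‖g z‖ ≤ evalBound n p t * Real.exp (‖z‖ ^ 2 / (2 * t)) * ‖g‖ := by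
  have h1 := (exists_norm_apply_zero_le n p t).choose_spec.2 (weyl (-z) g)
  rw [norm_weyl, weyl_apply, zero_sub, neg_neg, norm_mul, normalizedKernel, inner_zero_right,
    zero_div, zero_sub, Complex.norm_exp, norm_neg, Complex.neg_re, Complex.ofReal_re,
    Real.exp_neg, inv_mul_le_iff₀ (Real.exp_pos _)] at h1
  refine h1.trans (le_of_eq ?_)
  rw [evalBound]
  ring

/-- Evaluation at a point as a bounded linear functional on `F_t^p`. -/
def evalCLM (z : Cn n) : FockSpace n p t →L[ℂ] ℂ :=
  LinearMap.mkContinuous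
    { toFun := fun g => g z
      map_add' := fun _ _ => rfl
      map_smul' := fun _ _ => rfl }
    (evalBound n p t * Real.exp (‖z‖ ^ 2 / (2 * t))) fun g => g.norm_apply_le z

theorem evalCLM_apply (z : Cn n) (g : FockSpace n p t) : evalCLM z g = g z := rfl

/-- The bounds on point evaluations are locally uniform in the point. Joint continuity is what
allows a varying function to be evaluated at a varying point. -/
theorem continuous_uncurry_eval :
    Continuous fun q : FockSpace n p t × Cn n => q.1 q.2 := by
  refine continuous_iff_continuousAt.2 fun ⟨g, z⟩ => ?_
  rw [ContinuousAt, tendsto_iff_norm_sub_tendsto_zero]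
  have h1 : Tendsto (fun q : FockSpace n p t × Cn n =>
      evalBound n p t * Real.exp (‖q.2‖ ^ 2 / (2 * t)) * ‖q.1 - g‖ + ‖g q.2 - g z‖)
      (𝓝 (g, z)) (𝓝 0) := by
    have hg := g.continuous
    have hc : Continuous fun q : FockSpace n p t × Cn n =>
        evalBound n p t * Real.exp (‖q.2‖ ^ 2 / (2 * t)) * ‖q.1 - g‖ + ‖g q.2 - g z‖ := by
      have := hg.comp (continuous_snd (X := FockSpace n p t) (Y := Cn n))
      fun_prop
    simpa using hc.tendsto (g, z)
  refine squeeze_zero (fun _ => norm_nonneg _) (fun q => ?_) h1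
  have h2 := (q.1 - g).norm_apply_le q.2
  rw [FockSpace.sub_apply] at h2
  calc ‖q.1 q.2 - g z‖ = ‖(q.1 q.2 - g q.2) + (g q.2 - g z)‖ := by rw [sub_add_sub_cancel]
    _ ≤ _ := (norm_add_le _ _).trans (by gcongr)

end

section

variable {n : ℕ} {p t : ℝ}

/-! ### The Gaussian approximate identity -/

theorem gaussian_sqrt_smul (n : ℕ) {s : ℝ} (hs : 0 < s) (w : Cn n) :
    gaussian n s (√s • w) = (s ^ n)⁻¹ * gaussian n 1 w := by
  have hpi := Real.pi_pos
  rw [gaussian, gaussian, norm_smul, Real.norm_of_nonneg (Real.sqrt_nonneg s), mul_pow √s,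
    Real.sq_sqrt hs.le, mul_div_cancel_left₀ _ hs.ne', mul_pow]
  field_simp

/-- Substitution z = √s w: the real dimension is 2n, so the Jacobian s^n cancels the normalization.
With the Gaussian fixed, the limit s → 0 becomes dominated convergence. -/
theorem integral_gaussian_smul_eq {X : Type*} [NormedAddCommGroup X] [NormedSpace ℂ X]
    {s : ℝ} (hs : 0 < s) (F : Cn n → X) :
    ∫ z, (gaussian n s z : ℂ) • F z = ∫ w, (gaussian n 1 w : ℂ) • F (√s • w) := by
  have h := Measure.integral_comp_smul (volume : Measure (Cn n))
    (fun z => (gaussian n s z : ℂ) • F z) √s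
  have hf : Module.finrank ℝ (Cn n) = 2 * n := by
    rw [finrank_real_of_complex, finrank_euclideanSpace_fin]
  have hsn : (0 : ℝ) < s ^ n := by positivity
  simp only [gaussian_sqrt_smul n hs] at h
  rw [hf, pow_mul, Real.sq_sqrt hs.le, abs_of_pos (inv_pos.2 hsn)] at h
  have h2 : ∀ w : Cn n, ((((s ^ n)⁻¹ * gaussian n 1 w : ℝ)) : ℂ) • F (√s • w) =
      (s ^ n)⁻¹ • ((gaussian n 1 w : ℂ) • F (√s • w)) := fun w => by
    rw [Complex.ofReal_mul, mul_smul, Complex.coe_smul]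
  simp_rw [h2] at h
  rw [integral_smul] at h
  exact (smul_right_injective _ (inv_pos.2 hsn).ne' h).symm

theorem tendsto_integral_gaussian_smul {X : Type*} [NormedAddCommGroup X] [NormedSpace ℂ X]
    [CompleteSpace X] {F : Cn n → X} (hF : Continuous F) {C : ℝ} (hC : ∀ z, ‖F z‖ ≤ C) :
    Tendsto (fun s : ℝ => ∫ z, (gaussian n s z : ℂ) • F z) (𝓝[>] 0) (𝓝 (F 0)) := by
  have h1 : ∫ w : Cn n, (gaussian n 1 w : ℂ) • F 0 = F 0 := by
    rw [integral_smul_const, integral_complex_ofReal, integral_gaussian n one_pos,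
      Complex.ofReal_one, one_smul]
  have hg : Continuous fun w : Cn n => (gaussian n 1 w : ℂ) :=
    Complex.continuous_ofReal.comp (continuous_gaussian n 1)
  have h2 : Tendsto (fun s : ℝ => ∫ w, (gaussian n 1 w : ℂ) • F (√s • w)) (𝓝[>] 0)
      (𝓝 (∫ w : Cn n, (gaussian n 1 w : ℂ) • F 0)) := by
    refine tendsto_integral_filter_of_dominated_convergence (fun w => gaussian n 1 w * C)
      (Eventually.of_forall fun s => ?_) (Eventually.of_forall fun s => ?_)
      ((integrable_gaussian n one_pos).mul_const C) (Eventually.of_forall fun w => ?_)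
    · exact (hg.smul (hF.comp (continuous_const_smul √s))).aestronglyMeasurable
    · refine Eventually.of_forall fun w => ?_
      have h0 := (gaussian_pos n one_pos w).le
      rw [norm_smul, Complex.norm_of_nonneg h0]
      exact mul_le_mul_of_nonneg_left (hC _) h0
    · refine Tendsto.const_smul ?_ _
      have h3 : Continuous fun s : ℝ => F (√s • w) := by fun_prop
      have h4 := h3.tendsto 0
      rw [Real.sqrt_zero, zero_smul] at h4
      exact h4.mono_left nhdsWithin_le_nhds
  rw [h1] at h2
  refine h2.congr' ?_
  filter_upwards [self_mem_nhdsWithin] with s hs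
  exact (integral_gaussian_smul_eq hs F).symm

theorem integrable_gaussian_smul {X : Type*} [NormedAddCommGroup X] [NormedSpace ℂ X]
    {F : Cn n → X} (hF : Continuous F) {C : ℝ} (hC : ∀ z, ‖F z‖ ≤ C) {s : ℝ} (hs : 0 < s) :
    Integrable fun z => (gaussian n s z : ℂ) • F z :=
  (integrable_ofReal_gaussian n hs).smul_bdd C hF.aestronglyMeasurable
    (Eventually.of_forall hC)

/-! ### Factorization in modules over an algebra with an approximate identity -/

/-- Write 2 - Γ = 2(1 - Γ/2) and use the Neumann series. The inverse is a contraction because ‖2y -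
Γy‖ ≥ ‖y‖. -/
theorem exists_inverse_two_sub {E : Type*} [NormedAddCommGroup E] [NormedSpace ℂ E]
    [CompleteSpace E] (Γ : E →L[ℂ] E) (hΓ : ∀ x, ‖Γ x‖ ≤ ‖x‖) :
    ∃ r : E →L[ℂ] E, (∀ x, (2 : ℂ) • r x - Γ (r x) = x) ∧
      (∀ x, r ((2 : ℂ) • x - Γ x) = x) ∧ ∀ x, ‖r x‖ ≤ ‖x‖ := by
  have hn : ‖(2⁻¹ : ℂ) • Γ‖ < 1 := by
    have h1 : ‖Γ‖ ≤ 1 := Γ.opNorm_le_bound zero_le_one fun x => by simpa using hΓ x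
    rw [norm_smul, norm_inv, Complex.norm_ofNat]
    linarith
  let u := Units.oneSub _ hn
  have hu : ∀ x, u.1 x = x - (2⁻¹ : ℂ) • Γ x := fun x => rfl
  have h1 : ∀ x, u.1 (u⁻¹.1 x) = x := fun x => by
    change (u.1 * u⁻¹.1) x = x
    rw [u.mul_inv]; rfl
  have h2 : ∀ x, u⁻¹.1 (u.1 x) = x := fun x => by
    change (u⁻¹.1 * u.1) x = x
    rw [u.inv_mul]; rfl
  have h3 : ∀ x, (2 : ℂ) • ((2⁻¹ : ℂ) • u⁻¹.1) x - Γ (((2⁻¹ : ℂ) • u⁻¹.1) x) = x := fun x => by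
    have := h1 x
    rw [hu] at this
    simp only [smul_apply, map_smul, smul_smul]
    rw [mul_inv_cancel₀ two_ne_zero, one_smul]
    exact this
  refine ⟨(2⁻¹ : ℂ) • u⁻¹.1, h3, fun x => ?_, fun x => ?_⟩
  · have := h2 x
    rw [hu] at this
    rw [smul_apply, ← map_smul, smul_sub, smul_smul,
      inv_mul_cancel₀ two_ne_zero, one_smul]
    exact this
  · set y := ((2⁻¹ : ℂ) • u⁻¹.1) x
    have h4 := h3 x
    have h5 : ‖(2 : ℂ) • y‖ = 2 * ‖y‖ := by rw [norm_smul, Complex.norm_ofNat]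
    have h6 := norm_sub_norm_le ((2 : ℂ) • y) (Γ y)
    rw [h4, h5] at h6
    linarith [hΓ y]

/-- A form of the Cohen factorization theorem for an approximate identity `γ` that acts by
commuting operators. -/
theorem exists_factorization {E X : Type*} [NormedAddCommGroup E] [NormedSpace ℂ E]
    [CompleteSpace E] [NormedAddCommGroup X] [NormedSpace ℂ X] [CompleteSpace X]
    (β : E →L[ℂ] X →L[ℂ] X) (Γ : ℝ → E →L[ℂ] E) (γ : ℝ → E) (C : Submodule ℂ X)
    (hC : IsClosed (C : Set X))
    (hΓ : ∀ s > 0, ∀ x, ‖Γ s x‖ ≤ ‖x‖) (hγ : ∀ s > 0, ‖γ s‖ ≤ 1)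
    (hΓlim : ∀ x, Tendsto (fun s => Γ s x) (𝓝[>] 0) (𝓝 x))
    (hβ : ∀ s > 0, ∀ x, ∀ A ∈ C, β (Γ s x) A = β x (β (γ s) A))
    (hmem : ∀ s > 0, ∀ A ∈ C, β (γ s) A ∈ C)
    (hlim : ∀ A ∈ C, Tendsto (fun s => β (γ s) A) (𝓝[>] 0) (𝓝 A)) {A : X} (hA : A ∈ C) :
    ∃ x : E, ∃ B ∈ C, A = β x B := by
  -- In the unitization of the algebra this says A = u_N B_N with u_N = 2^{-N} + x_N. The scalar
  -- part of u_N is driven to zero while x_N and B_N converge.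
  let P : ℕ → X × E → Prop := fun N σ =>
    σ.1 ∈ C ∧ A = ((2⁻¹ : ℂ) ^ N) • σ.1 + β σ.2 σ.1
  have step : ∀ N σ, P N σ → ∃ σ', P (N + 1) σ' ∧ dist σ.1 σ'.1 ≤ 2 * (1 / 2) ^ N ∧
      dist σ.2 σ'.2 ≤ 2 * (1 / 2) ^ N := by
    rintro N ⟨B, x⟩ ⟨hB, hAB⟩
    simp only at hB hAB ⊢
    have hε : (0 : ℝ) < (1 / 2) ^ N := by positivity
    obtain ⟨s, ⟨hs1, hs2⟩, hs⟩ := (((Metric.tendsto_nhds.1 (hlim B hB) _ hε).and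
      (Metric.tendsto_nhds.1 (hΓlim x) _ hε)).and self_mem_nhdsWithin).exists
    have hs : 0 < s := hs
    obtain ⟨r, hr1, hr2, hr3⟩ := exists_inverse_two_sub (Γ s) (hΓ s hs)
    set B' := (2 : ℂ) • B - β (γ s) B with hB'
    have hB'C : B' ∈ C := C.sub_mem (C.smul_mem _ hB) (hmem s hs B hB)
    have hrβ : ∀ y, β (r y) B' = β y B := fun y => by
      rw [hB', map_sub, map_smul, ← hβ s hs _ _ hB, ← smul_apply, ← map_smul,
        ← sub_apply, ← map_sub, hr1]
    -- Here u_{N+1} = u_N (2 - γ)^{-1} and B_{N+1} = (2 - γ) B_N, which leaves the product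
    -- unchanged. The second summand is the non-scalar part of 2^{-N}(2 - γ)^{-1} = 2^{-(N+1)} +
    -- 2^{-(N+1)} γ (2 - γ)^{-1}.
    refine ⟨(B', r x + ((2⁻¹ : ℂ) ^ (N + 1)) • r (γ s)), ⟨hB'C, ?_⟩, ?_, ?_⟩
    · simp only
      rw [map_add, map_smul, add_apply, smul_apply, hrβ,
        hrβ, hB', hAB, smul_sub, smul_smul, pow_succ, mul_assoc, inv_mul_cancel₀ two_ne_zero,
        mul_one]
      abel
    · simp only [hB']
      rw [dist_eq_norm] at hs1 ⊢
      have : B - ((2 : ℂ) • B - β (γ s) B) = β (γ s) B - B := by rw [two_smul]; abel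
      rw [this]
      linarith
    · simp only
      rw [dist_comm, dist_eq_norm, add_sub_right_comm]
      have h1 : r x - x = r (Γ s x - x) := by
        nth_rewrite 2 [← hr2 x]
        rw [← map_sub, two_smul]
        congr 1
        abel
      have h2 : ‖r x - x‖ ≤ (1 / 2) ^ N := by
        rw [h1]
        exact (hr3 _).trans (by rw [← dist_eq_norm]; exact hs2.le)
      have h3 : ‖((2⁻¹ : ℂ) ^ (N + 1)) • r (γ s)‖ ≤ (1 / 2) ^ N := by
        rw [norm_smul, norm_pow, norm_inv, Complex.norm_ofNat, pow_succ, one_div]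
        have h4 := (hr3 (γ s)).trans (hγ s hs)
        have h5 : (0 : ℝ) < 2⁻¹ ^ N := by positivity
        nlinarith [norm_nonneg (r (γ s))]
      exact (norm_add_le _ _).trans (by linarith)
  -- The iteration starts from u_0 = 1, that is from B_0 = A and x_0 = 0.
  let σ : ∀ N, {σ // P N σ} := fun N => Nat.rec ⟨(A, 0), hA, by simp⟩
    (fun N σ => ⟨(step N σ.1 σ.2).choose, (step N σ.1 σ.2).choose_spec.1⟩) N
  have hσ : ∀ N, dist (σ N).1.1 (σ (N + 1)).1.1 ≤ 2 * (1 / 2) ^ N ∧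
      dist (σ N).1.2 (σ (N + 1)).1.2 ≤ 2 * (1 / 2) ^ N := fun N =>
    (step N (σ N).1 (σ N).2).choose_spec.2
  obtain ⟨B, hB⟩ := cauchySeq_tendsto_of_complete
    (cauchySeq_of_le_geometric (1 / 2) 2 (by norm_num) fun N => (hσ N).1)
  obtain ⟨x, hx⟩ := cauchySeq_tendsto_of_complete
    (cauchySeq_of_le_geometric (1 / 2) 2 (by norm_num) fun N => (hσ N).2)
  refine ⟨x, B, hC.mem_of_tendsto hB (Eventually.of_forall fun N => (σ N).2.1), ?_⟩
  have h1 : Tendsto (fun N : ℕ => (2⁻¹ : ℂ) ^ N) atTop (𝓝 0) :=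
    tendsto_pow_atTop_nhds_zero_of_norm_lt_one (by norm_num)
  have h2 := (h1.smul hB).add ((β.continuous₂.tendsto (x, B)).comp (hx.prodMk_nhds hB))
  rw [zero_smul, zero_add] at h2
  exact tendsto_nhds_unique (tendsto_const_nhds.congr fun N => (σ N).2.2) h2

end

section

variable {n : ℕ} {p t : ℝ} [Fact (1 < p)] [Fact (0 < t)]

/-! ### Algebra of translations -/

/-- The phase in `W_z W_w = exp ((w · z̄ - z · w̄) / (2t)) W_{z+w}`. -/
def weylPhase (t : ℝ) (z w : Cn n) : ℂ :=
  Complex.exp ((inner ℂ z w - inner ℂ w z) / (2 * t))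

theorem weyl_weyl (z w : Cn n) (f : FockSpace n p t) :
    weyl z (weyl w f) = weylPhase t z w • weyl (z + w) f := by
  have ht : 0 < t := Fact.out
  have htc : (t : ℂ) ≠ 0 := by exact_mod_cast ht.ne'
  refine FockSpace.ext fun x => ?_
  rw [FockSpace.smul_apply, weyl_apply, weyl_apply, weyl_apply, sub_sub, ← mul_assoc, ← mul_assoc]
  congr 1
  rw [weylPhase, normalizedKernel, normalizedKernel, normalizedKernel, ← Complex.exp_add,
    ← Complex.exp_add]
  congr 1
  have h : ∀ z : Cn n, ((‖z‖ : ℂ)) ^ 2 = inner ℂ z z := fun z =>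
    (inner_self_eq_norm_sq_to_K z).symm
  push_cast
  simp only [h, inner_add_left, inner_add_right, inner_sub_right]
  field_simp
  ring

theorem weyl_zero (f : FockSpace n p t) : weyl 0 f = f := by
  refine FockSpace.ext fun x => ?_
  rw [weyl_apply, normalizedKernel, inner_zero_left, sub_zero]
  simp

theorem weyl_weyl_neg (z : Cn n) (f : FockSpace n p t) : weyl z (weyl (-z) f) = f := by
  rw [weyl_weyl, add_neg_cancel, weyl_zero, weylPhase, inner_neg_right, inner_neg_left, sub_self,
    zero_div, Complex.exp_zero, one_smul]

theorem weyl_neg_weyl (z : Cn n) (f : FockSpace n p t) : weyl (-z) (weyl z f) = f := by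
  simpa using weyl_weyl_neg (-z) f

theorem translate_apply (z : Cn n) (A : FockSpace n p t →L[ℂ] FockSpace n p t)
    (x : FockSpace n p t) : translate z A x = weyl z (A (weyl (-z) x)) := rfl

theorem translate_zero (A : FockSpace n p t →L[ℂ] FockSpace n p t) : translate 0 A = A := by
  ext1 x
  rw [translate_apply, neg_zero, weyl_zero, weyl_zero]

/-- The Weyl operators form only a projective representation, but the two phases cancel under
conjugation, so α is a genuine action of the additive group. -/
theorem translate_translate (z w : Cn n) (A : FockSpace n p t →L[ℂ] FockSpace n p t) :
    translate z (translate w A) = translate (z + w) A := by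
  ext1 x
  rw [translate_apply, translate_apply, translate_apply, weyl_weyl, weyl_weyl, map_smul, map_smul,
    smul_smul, neg_add_rev]
  have h : weylPhase t z w * weylPhase t (-w) (-z) = 1 := by
    rw [weylPhase, weylPhase, ← Complex.exp_add, inner_neg_neg, inner_neg_neg, ← add_div,
      sub_add_sub_cancel, sub_self, zero_div, Complex.exp_zero]
  rw [h, one_smul]

theorem translate_comm (z w : Cn n) (A : FockSpace n p t →L[ℂ] FockSpace n p t) :
    translate z (translate w A) = translate w (translate z A) := by
  rw [translate_translate, translate_translate, add_comm]

theorem translate_add (z : Cn n) (A B : FockSpace n p t →L[ℂ] FockSpace n p t) :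
    translate z (A + B) = translate z A + translate z B := by
  ext1 x
  simp [translate_apply]

theorem translate_sub (z : Cn n) (A B : FockSpace n p t →L[ℂ] FockSpace n p t) :
    translate z (A - B) = translate z A - translate z B := by
  ext1 x
  simp [translate_apply]

theorem translate_smul (z : Cn n) (c : ℂ) (A : FockSpace n p t →L[ℂ] FockSpace n p t) :
    translate z (c • A) = c • translate z A := by
  ext1 x
  simp [translate_apply]

theorem translate_mul (z : Cn n) (A B : FockSpace n p t →L[ℂ] FockSpace n p t) :
    translate z (A * B) = translate z A * translate z B := by
  ext1 x
  change weyl z (A (B (weyl (-z) x))) = weyl z (A (weyl (-z) (weyl z (B (weyl (-z) x)))))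
  rw [weyl_neg_weyl]

theorem norm_translate_le (z : Cn n) (A : FockSpace n p t →L[ℂ] FockSpace n p t) :
    ‖translate z A‖ ≤ ‖A‖ :=
  (translate z A).opNorm_le_bound (norm_nonneg _) (norm_translate_apply_le z A)

theorem norm_translate (z : Cn n) (A : FockSpace n p t →L[ℂ] FockSpace n p t) :
    ‖translate z A‖ = ‖A‖ := by
  refine le_antisymm (norm_translate_le z A) ?_
  have h := norm_translate_le (-z) (translate z A)
  rwa [translate_translate, neg_add_cancel, translate_zero] at h

theorem norm_translate_sub_translate (z w : Cn n) (A : FockSpace n p t →L[ℂ] FockSpace n p t) :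
    ‖translate z A - translate w A‖ = ‖translate (z - w) A - A‖ := by
  rw [← norm_translate w (translate (z - w) A - A), translate_sub, translate_translate,
    add_sub_cancel]

/-! ### Norm continuous operators -/

/-- Because α acts isometrically, ‖α_z A - α_w A‖ depends only on z - w; continuity at 0 therefore
already gives continuity everywhere. -/
theorem mem_normContinuousOperators_iff {A : FockSpace n p t →L[ℂ] FockSpace n p t} :
    A ∈ normContinuousOperators n p t ↔
      Tendsto (fun z : Cn n => ‖translate z A - A‖) (𝓝 0) (𝓝 0) := by
  rw [← tendsto_iff_norm_sub_tendsto_zero]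
  refine ⟨fun h => ?_, fun h => ?_⟩
  · have h1 := Continuous.tendsto (f := fun z : Cn n => translate z A) h 0
    rwa [translate_zero] at h1
  · refine continuous_iff_continuousAt.2 fun w => ?_
    rw [ContinuousAt, tendsto_iff_norm_sub_tendsto_zero]
    simp_rw [norm_translate_sub_translate]
    rw [tendsto_iff_norm_sub_tendsto_zero] at h
    refine h.comp ?_
    simpa using (continuous_id.sub continuous_const).tendsto (f := fun z : Cn n => z - w) w

theorem uniformContinuous_translate {A : FockSpace n p t →L[ℂ] FockSpace n p t}
    (hA : A ∈ normContinuousOperators n p t) : UniformContinuous fun z : Cn n => translate z A := by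
  rw [mem_normContinuousOperators_iff, Metric.tendsto_nhds_nhds] at hA
  refine Metric.uniformContinuous_iff.2 fun ε hε => ?_
  obtain ⟨δ, hδ, h⟩ := hA ε hε
  refine ⟨δ, hδ, fun {z w} hzw => ?_⟩
  have h1 := h (x := z - w) (by rwa [dist_zero_right, ← dist_eq_norm])
  rwa [dist_zero_right, norm_norm, ← norm_translate_sub_translate, ← dist_eq_norm] at h1

variable (n p t) in
/-- `C₁` as a subalgebra. -/
def normContinuousAlgebra : NonUnitalSubalgebra ℂ (FockSpace n p t →L[ℂ] FockSpace n p t) where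
  carrier := normContinuousOperators n p t
  zero_mem' := by
    have h : ∀ z : Cn n, translate z (0 : FockSpace n p t →L[ℂ] FockSpace n p t) = 0 := fun z => by
      ext1 x
      simp [translate_apply]
    change Continuous fun z : Cn n => translate z (0 : FockSpace n p t →L[ℂ] FockSpace n p t)
    simp_rw [h]
    exact continuous_const
  add_mem' {A B} hA hB := by
    change Continuous fun z : Cn n => translate z (A + B)
    simp_rw [translate_add]
    exact Continuous.add hA hB
  smul_mem' c A hA := by
    change Continuous fun z : Cn n => translate z (c • A)
    simp_rw [translate_smul]
    exact Continuous.const_smul hA c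
  mul_mem' {A B} hA hB := by
    change Continuous fun z : Cn n => translate z (A * B)
    simp_rw [translate_mul]
    exact Continuous.mul hA hB

theorem isClosed_normContinuousOperators :
    IsClosed (normContinuousOperators n p t) := by
  refine isClosed_of_closure_subset fun A hA => ?_
  rw [mem_normContinuousOperators_iff]
  refine Metric.tendsto_nhds.2 fun ε hε => ?_
  obtain ⟨B, hB, hAB⟩ := Metric.mem_closure_iff.1 hA (ε / 3) (by positivity)
  filter_upwards [Metric.tendsto_nhds.1 (mem_normContinuousOperators_iff.1 hB) (ε / 3)
    (by positivity)] with z hz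
  rw [dist_zero_right, norm_norm] at hz ⊢
  rw [dist_eq_norm] at hAB
  calc ‖translate z A - A‖ = ‖translate z (A - B) + (translate z B - B) - (A - B)‖ := by
        rw [translate_sub]; congr 1; abel
    _ ≤ ‖translate z (A - B)‖ + ‖translate z B - B‖ + ‖A - B‖ :=
        (norm_sub_le _ _).trans (add_le_add_left (norm_add_le _ _) _)
    _ < ε := by rw [norm_translate]; linarith

/-! ### Convolution of functions and operators -/

theorem conv_apply {g : Cn n → ℂ} (hg : Integrable g) (A : FockSpace n p t →L[ℂ] FockSpace n p t)
    (x : FockSpace n p t) : conv g A x = ∫ z, g z • translate z A x := by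
  rw [conv, dif_pos hg]
  rfl

theorem norm_conv_le {g : Cn n → ℂ} (hg : Integrable g)
    (A : FockSpace n p t →L[ℂ] FockSpace n p t) : ‖conv g A‖ ≤ (∫ z, ‖g z‖) * ‖A‖ := by
  rw [conv, dif_pos hg]
  exact LinearMap.mkContinuous_norm_le _
    (mul_nonneg (integral_nonneg fun _ => norm_nonneg _) (norm_nonneg _)) _

theorem conv_congr {g h : Cn n → ℂ} (hg : Integrable g) (hgh : g =ᵐ[volume] h)
    (A : FockSpace n p t →L[ℂ] FockSpace n p t) : conv g A = conv h A := by
  ext1 x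
  rw [conv_apply hg, conv_apply (hg.congr hgh)]
  refine integral_congr_ae ?_
  filter_upwards [hgh] with z hz
  rw [hz]

theorem conv_add_left {g h : Cn n → ℂ} (hg : Integrable g) (hh : Integrable h)
    (A : FockSpace n p t →L[ℂ] FockSpace n p t) : conv (g + h) A = conv g A + conv h A := by
  ext1 x
  rw [add_apply, conv_apply hg, conv_apply hh, conv_apply (hg.add hh),
    ← integral_add (integrable_smul_translate hg A x) (integrable_smul_translate hh A x)]
  simp_rw [Pi.add_apply, add_smul]

theorem conv_smul_left (c : ℂ) {g : Cn n → ℂ} (hg : Integrable g)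
    (A : FockSpace n p t →L[ℂ] FockSpace n p t) : conv (c • g) A = c • conv g A := by
  ext1 x
  rw [_root_.smul_apply, conv_apply hg, conv_apply (hg.smul c), ← integral_smul]
  simp_rw [Pi.smul_apply, smul_assoc]

theorem conv_add_right {g : Cn n → ℂ} (hg : Integrable g)
    (A B : FockSpace n p t →L[ℂ] FockSpace n p t) : conv g (A + B) = conv g A + conv g B := by
  ext1 x
  rw [add_apply, conv_apply hg, conv_apply hg, conv_apply hg,
    ← integral_add (integrable_smul_translate hg A x) (integrable_smul_translate hg B x)]
  simp_rw [translate_add, add_apply, smul_add]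

theorem conv_sub_right {g : Cn n → ℂ} (hg : Integrable g)
    (A B : FockSpace n p t →L[ℂ] FockSpace n p t) : conv g (A - B) = conv g A - conv g B := by
  ext1 x
  rw [sub_apply, conv_apply hg, conv_apply hg, conv_apply hg,
    ← integral_sub (integrable_smul_translate hg A x) (integrable_smul_translate hg B x)]
  simp_rw [translate_sub, sub_apply, smul_sub]

theorem conv_smul_right (c : ℂ) {g : Cn n → ℂ} (hg : Integrable g)
    (A : FockSpace n p t →L[ℂ] FockSpace n p t) : conv g (c • A) = c • conv g A := by
  ext1 x
  rw [_root_.smul_apply, conv_apply hg, conv_apply hg, ← integral_smul]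
  simp_rw [translate_smul, _root_.smul_apply, smul_comm c]

theorem translate_conv {g : Cn n → ℂ} (hg : Integrable g) (z : Cn n)
    (A : FockSpace n p t →L[ℂ] FockSpace n p t) :
    translate z (conv g A) = conv g (translate z A) := by
  ext1 x
  rw [translate_apply, conv_apply hg, conv_apply hg,
    ← ContinuousLinearMap.integral_comp_comm _ (integrable_smul_translate hg A _)]
  refine integral_congr_ae (Eventually.of_forall fun w => ?_)
  simp only
  rw [map_smul, translate_comm w z, translate_apply z]

theorem conv_translate {g : Cn n → ℂ} (hg : Integrable g) (z : Cn n)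
    (A : FockSpace n p t →L[ℂ] FockSpace n p t) :
    conv g (translate z A) = conv (fun w => g (w - z)) A := by
  ext1 x
  rw [conv_apply hg, conv_apply (hg.comp_sub_right z),
    ← integral_sub_right_eq_self (fun w => g w • translate w (translate z A) x) z]
  simp_rw [translate_translate, sub_add_cancel]

/-- For A in C₁ the integral converges in operator norm, not just strongly. Bounded functionals and
bilinear maps on operators can then be moved under the integral sign. -/
theorem conv_eq_integral {g : Cn n → ℂ} (hg : Integrable g)
    {A : FockSpace n p t →L[ℂ] FockSpace n p t} (hA : A ∈ normContinuousOperators n p t) :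
    Integrable (fun z => g z • translate z A) ∧ conv g A = ∫ z, g z • translate z A := by
  have hi : Integrable fun z => g z • translate z A :=
    hg.smul_bdd ‖A‖ (Continuous.aestronglyMeasurable hA)
      (Eventually.of_forall fun z => norm_translate_le z A)
  refine ⟨hi, ?_⟩
  ext1 x
  rw [conv_apply hg, ContinuousLinearMap.integral_apply hi]
  rfl

theorem conv_mem_normContinuousOperators {g : Cn n → ℂ} (hg : Integrable g)
    {A : FockSpace n p t →L[ℂ] FockSpace n p t} (hA : A ∈ normContinuousOperators n p t) :
    conv g A ∈ normContinuousOperators n p t := by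
  rw [mem_normContinuousOperators_iff] at hA ⊢
  have h := hA.const_mul (∫ z, ‖g z‖)
  rw [mul_zero] at h
  refine squeeze_zero (fun _ => norm_nonneg _) (fun z => ?_) h
  rw [translate_conv hg, ← conv_sub_right hg]
  exact norm_conv_le hg _

theorem tendsto_conv_gaussian {A : FockSpace n p t →L[ℂ] FockSpace n p t}
    (hA : A ∈ normContinuousOperators n p t) :
    Tendsto (fun s : ℝ => conv (fun z : Cn n => (gaussian n s z : ℂ)) A) (𝓝[>] 0) (𝓝 A) := by
  have h := tendsto_integral_gaussian_smul (F := fun z : Cn n => translate z A) hA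
    (fun z => norm_translate_le z A)
  rw [translate_zero] at h
  refine h.congr' ?_
  filter_upwards [self_mem_nhdsWithin] with s hs
  exact (conv_eq_integral (integrable_ofReal_gaussian n hs) hA).2.symm

/-! ### Translations on `L¹` -/

/-- The translation `(τ_z g)(w) = g(w - z)` on `L¹(ℂⁿ)`. -/
def translateL1 (z : Cn n) :
    Lp ℂ 1 (volume : Measure (Cn n)) →ₗᵢ[ℂ] Lp ℂ 1 (volume : Measure (Cn n)) :=
  Lp.compMeasurePreservingₗᵢ ℂ (fun w => w - z) (measurePreserving_sub_right volume z)

theorem coeFn_translateL1 (z : Cn n) (g : Lp ℂ 1 (volume : Measure (Cn n))) :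
    translateL1 z g =ᵐ[volume] fun w => g (w - z) :=
  Lp.coeFn_compMeasurePreserving g (measurePreserving_sub_right volume z)

theorem continuous_translateL1 (g : Lp ℂ 1 (volume : Measure (Cn n))) :
    Continuous fun z : Cn n => translateL1 z g := by
  have h : Continuous fun z : Cn n => (⟨fun w => w - z, by fun_prop⟩ : C(Cn n, Cn n)) := by
    refine ContinuousMap.continuous_of_continuous_uncurry _ ?_
    exact continuous_snd.sub continuous_fst
  exact Continuous.compMeasurePreservingLp continuous_const h
    (fun z => measurePreserving_sub_right volume z) ENNReal.one_ne_top

theorem translateL1_zero (g : Lp ℂ 1 (volume : Measure (Cn n))) : translateL1 0 g = g := by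
  refine Lp.ext ?_
  filter_upwards [coeFn_translateL1 0 g] with w hw
  rw [hw, sub_zero]

/-- Convolution as a bounded bilinear map. -/
def convL1 : Lp ℂ 1 (volume : Measure (Cn n)) →L[ℂ]
    (FockSpace n p t →L[ℂ] FockSpace n p t) →L[ℂ] (FockSpace n p t →L[ℂ] FockSpace n p t) :=
  LinearMap.mkContinuous₂
    (LinearMap.mk₂ ℂ (fun (g : Lp ℂ 1 (volume : Measure (Cn n))) A => conv g A)
      (fun g h A => by
        rw [conv_congr (L1.integrable_coeFn _) (Lp.coeFn_add g h),
          conv_add_left (L1.integrable_coeFn g) (L1.integrable_coeFn h)])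
      (fun c g A => by
        rw [conv_congr (L1.integrable_coeFn _) (Lp.coeFn_smul c g),
          conv_smul_left c (L1.integrable_coeFn g)])
      (fun g A B => conv_add_right (L1.integrable_coeFn g) A B)
      (fun c g A => conv_smul_right c (L1.integrable_coeFn g) A)) 1 fun g A => by
    rw [one_mul, L1.norm_eq_integral_norm]
    exact norm_conv_le (L1.integrable_coeFn g) A

theorem convL1_apply (g : Lp ℂ 1 (volume : Measure (Cn n)))
    (A : FockSpace n p t →L[ℂ] FockSpace n p t) : convL1 g A = conv g A := rfl

theorem convL1_toL1 {g : Cn n → ℂ} (hg : Integrable g)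
    (A : FockSpace n p t →L[ℂ] FockSpace n p t) : convL1 (hg.toL1 g) A = conv g A :=
  conv_congr (L1.integrable_coeFn _) hg.coeFn_toL1 A

theorem convL1_translateL1 (z : Cn n) (g : Lp ℂ 1 (volume : Measure (Cn n)))
    (A : FockSpace n p t →L[ℂ] FockSpace n p t) :
    convL1 (translateL1 z g) A = convL1 g (translate z A) := by
  rw [convL1_apply, convL1_apply, conv_translate (L1.integrable_coeFn g),
    conv_congr (L1.integrable_coeFn _) (coeFn_translateL1 z g)]

/-- The translation can be shifted onto g, since α_z(g * A) = (τ_z g) * A, and z ↦ τ_z g is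
continuous in L¹. Nothing is asked of A, so this applies to operators not yet known to lie in C₁. -/
theorem conv_mem_normContinuousOperators_of_integrable {g : Cn n → ℂ} (hg : Integrable g)
    (A : FockSpace n p t →L[ℂ] FockSpace n p t) : conv g A ∈ normContinuousOperators n p t := by
  change Continuous fun z : Cn n => translate z (conv g A)
  have h : ∀ z : Cn n, translate z (conv g A) = convL1 (translateL1 z (hg.toL1 g)) A := fun z => by
    rw [convL1_translateL1, convL1_toL1, translate_conv hg]
  simp_rw [h]
  exact (convL1.continuous.comp (continuous_translateL1 _)).clm_apply continuous_const

theorem norm_integral_gaussian_translateL1_le {s : ℝ} (hs : 0 < s)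
    (g : Lp ℂ 1 (volume : Measure (Cn n))) :
    ‖∫ z, (gaussian n s z : ℂ) • translateL1 z g‖ ≤ ‖g‖ := by
  refine (norm_integral_le_integral_norm _).trans (le_of_eq ?_)
  simp_rw [norm_smul, LinearIsometry.norm_map]
  rw [integral_mul_const, integral_norm_gaussian n hs, one_mul]

/-- Convolution with a Gaussian on `L¹(ℂⁿ)`. -/
def gaussianConvL1 (n : ℕ) {s : ℝ} (hs : 0 < s) :
    Lp ℂ 1 (volume : Measure (Cn n)) →L[ℂ] Lp ℂ 1 (volume : Measure (Cn n)) :=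
  have hi := fun g => integrable_gaussian_smul (continuous_translateL1 g)
    (fun z => (LinearIsometry.norm_map _ _).le) hs
  LinearMap.mkContinuous
    { toFun := fun g => ∫ z, (gaussian n s z : ℂ) • translateL1 z g
      map_add' := fun g h => by
        simp_rw [map_add, smul_add]
        exact integral_add (hi g) (hi h)
      map_smul' := fun c g => by
        simp_rw [map_smul, smul_comm _ c]
        exact integral_smul c _ }
    1 fun g => (norm_integral_gaussian_translateL1_le hs g).trans_eq (one_mul _).symm

theorem norm_gaussianConvL1_le {s : ℝ} (hs : 0 < s) (g : Lp ℂ 1 (volume : Measure (Cn n))) :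
    ‖gaussianConvL1 n hs g‖ ≤ ‖g‖ :=
  norm_integral_gaussian_translateL1_le hs g

theorem gaussianConvL1_apply {s : ℝ} (hs : 0 < s) (g : Lp ℂ 1 (volume : Measure (Cn n))) :
    gaussianConvL1 n hs g = ∫ z, (gaussian n s z : ℂ) • translateL1 z g := rfl

/-- Associativity (f_s * g) * A = g * (f_s * A): both sides are f_s-averages, and each translation
passes from g to A. Membership in C₁ lets the average of α_z(A) leave the operator slot as a norm
integral. -/
theorem convL1_gaussianConvL1 {s : ℝ} (hs : 0 < s) (g : Lp ℂ 1 (volume : Measure (Cn n)))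
    {A : FockSpace n p t →L[ℂ] FockSpace n p t} (hA : A ∈ normContinuousOperators n p t) :
    convL1 (gaussianConvL1 n hs g) A =
      convL1 g (conv (fun z : Cn n => (gaussian n s z : ℂ)) A) := by
  obtain ⟨hi, he⟩ := conv_eq_integral (integrable_ofReal_gaussian n hs) hA
  rw [he, ← ContinuousLinearMap.integral_comp_comm _ hi, gaussianConvL1_apply]
  have hi2 := integrable_gaussian_smul (continuous_translateL1 g)
    (fun z => (LinearIsometry.norm_map _ _).le) hs
  have h := ContinuousLinearMap.integral_comp_comm (convL1.flip A) hi2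
  simp only [ContinuousLinearMap.flip_apply] at h
  rw [← h]
  refine integral_congr_ae (Eventually.of_forall fun z => ?_)
  simp only
  rw [map_smul, map_smul, _root_.smul_apply, convL1_translateL1]

/-- Cohen factorization with L¹ acting on C₁ by convolution and the Gaussians as approximate
identity. -/
theorem exists_eq_conv {A : FockSpace n p t →L[ℂ] FockSpace n p t}
    (hA : A ∈ normContinuousOperators n p t) :
    ∃ g : Cn n → ℂ, Integrable g ∧ ∃ B ∈ normContinuousOperators n p t, A = conv g B := by
  -- The value 0 at s ≤ 0 is a filler; only the limit s → 0⁺ matters.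
  let γ : ℝ → Lp ℂ 1 (volume : Measure (Cn n)) := fun s =>
    if hs : 0 < s then (integrable_ofReal_gaussian n hs).toL1 _ else 0
  have hγ : ∀ s, ∀ hs : 0 < s, γ s = (integrable_ofReal_gaussian n hs).toL1 _ := fun s hs =>
    dif_pos hs
  let Γ : ℝ → Lp ℂ 1 (volume : Measure (Cn n)) →L[ℂ] Lp ℂ 1 (volume : Measure (Cn n)) := fun s =>
    if hs : 0 < s then gaussianConvL1 n hs else 0
  have hΓ : ∀ s, ∀ hs : 0 < s, Γ s = gaussianConvL1 n hs := fun s hs => dif_pos hs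
  have hγA : ∀ s, ∀ hs : 0 < s, ∀ A : FockSpace n p t →L[ℂ] FockSpace n p t,
      convL1 (γ s) A = conv (fun z : Cn n => (gaussian n s z : ℂ)) A := fun s hs A => by
    rw [hγ s hs, convL1_toL1]
  obtain ⟨g, B, hB, h⟩ := exists_factorization convL1 Γ γ (normContinuousAlgebra n p t).toSubmodule
    isClosed_normContinuousOperators
    (fun s hs g => by
      rw [hΓ s hs]
      exact norm_gaussianConvL1_le hs g)
    (fun s hs => by
      rw [hγ s hs, L1.norm_of_fun_eq_integral_norm, integral_norm_gaussian n hs])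
    (fun g => by
      have h := tendsto_integral_gaussian_smul (continuous_translateL1 g)
        (fun z => (LinearIsometry.norm_map _ _).le)
      rw [translateL1_zero] at h
      refine h.congr' ?_
      filter_upwards [self_mem_nhdsWithin] with s hs
      rw [hΓ s (Set.mem_Ioi.1 hs)]
      rfl)
    (fun s hs g A hA => by rw [hΓ s hs, hγA s hs, convL1_gaussianConvL1 hs g hA])
    (fun s hs A hA => by
      rw [hγA s hs]
      exact conv_mem_normContinuousOperators (integrable_ofReal_gaussian n hs) hA)
    (fun A hA => by
      refine (tendsto_conv_gaussian hA).congr' ?_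
      filter_upwards [self_mem_nhdsWithin] with s hs
      rw [hγA s (Set.mem_Ioi.1 hs)]) (A := A) hA
  exact ⟨g, L1.integrable_coeFn g, B, hB, h⟩

end

section

section

variable {n : ℕ} {p t : ℝ}

/-! ### Toeplitz operators are norm continuous -/

/-- The unimodular function `w ↦ exp ((w · z̄ - z · w̄) / t)`. -/
def phase (t : ℝ) (z w : Cn n) : ℂ := Complex.exp ((inner ℂ z w - inner ℂ w z) / t)

theorem norm_phase (t : ℝ) (z w : Cn n) : ‖phase t z w‖ = 1 := by
  rw [phase, Complex.norm_exp, Complex.div_ofReal_re, Complex.sub_re, ← inner_conj_symm z w,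
    Complex.conj_re, sub_self, zero_div, Real.exp_zero]

theorem phase_mul_phase_neg (t : ℝ) (z w : Cn n) : phase t z w * phase t (-z) w = 1 := by
  rw [phase, phase, ← Complex.exp_add, inner_neg_left, inner_neg_right, ← add_div]
  simp

theorem continuous_phase (t : ℝ) (z : Cn n) : Continuous (phase t z) := by
  unfold phase; fun_prop

/-- The function `exp (z · v̄ / t - |z|² / (2t)) - 1` of `v`. -/
def kernelDefect (t : ℝ) (z v : Cn n) : ℂ :=
  Complex.exp (inner ℂ v z / t - (‖z‖ ^ 2 / (2 * t) : ℝ)) - 1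

/-- The errors for W_z on the Fock space and for W_z P produce conjugate exponentials. Equality of
their moduli lets `weylDefect` control both. -/
theorem norm_kernelDefect_conj (t : ℝ) (z v : Cn n) :
    ‖Complex.exp (inner ℂ z v / t - (‖z‖ ^ 2 / (2 * t) : ℝ)) - 1‖ = ‖kernelDefect t z v‖ := by
  rw [kernelDefect, ← Complex.norm_conj]
  simp only [map_sub, map_one, ← Complex.exp_conj, map_div₀, Complex.conj_ofReal, inner_conj_symm]

theorem continuous_kernelDefect (t : ℝ) (z : Cn n) : Continuous (kernelDefect t z) := by
  unfold kernelDefect; fun_prop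

theorem norm_kernelDefect_le (ht : 0 < t) {z : Cn n} (hz : ‖z‖ ≤ 1) (v : Cn n) :
    ‖kernelDefect t z v‖ ≤ 2 * Real.exp (‖v‖ / t) := by
  have h1 : (inner ℂ v z).re ≤ ‖v‖ := by
    calc (inner ℂ v z).re ≤ ‖v‖ * ‖z‖ := (Complex.re_le_norm _).trans (norm_inner_le_norm v z)
      _ ≤ ‖v‖ := mul_le_of_le_one_right (norm_nonneg _) hz
  have h2 : ‖Complex.exp (inner ℂ v z / t - (‖z‖ ^ 2 / (2 * t) : ℝ))‖ ≤ Real.exp (‖v‖ / t) := by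
    rw [Complex.norm_exp, Complex.sub_re, Complex.div_ofReal_re, Complex.ofReal_re, Real.exp_le_exp]
    have h3 : (inner ℂ v z).re / t ≤ ‖v‖ / t := by gcongr
    have h4 : 0 ≤ ‖z‖ ^ 2 / (2 * t) := by positivity
    linarith
  have h5 : 1 ≤ Real.exp (‖v‖ / t) := Real.one_le_exp (by positivity)
  refine (norm_sub_le _ _).trans ?_
  rw [norm_one]
  linarith

/-- The `L¹` norm of the kernel that measures the failure of `W_z` to act as multiplication by
`phase t z`. -/
def weylDefect (n : ℕ) (t : ℝ) (z : Cn n) : ℝ≥0∞ :=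
  ENNReal.ofReal (1 / (Real.pi * t) ^ n) * ∫⁻ v, ‖kernelDefect t z v‖ₑ * weight t v

/-- The defect tends to 0 pointwise and, for ‖z‖ ≤ 1, grows at most like exp(|v|/t), which the
Gaussian weight absorbs. Dominated convergence applies. -/
theorem tendsto_weylDefect (n : ℕ) (ht : 0 < t) :
    Tendsto (weylDefect n t) (𝓝 0) (𝓝 0) := by
  have h1 : Tendsto (fun z : Cn n => ∫⁻ v, ‖kernelDefect t z v‖ₑ * weight t v) (𝓝 0)
      (𝓝 (∫⁻ _ : Cn n, 0)) := by
    refine tendsto_lintegral_filter_of_dominated_convergence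
      (fun v => ENNReal.ofReal (2 * Real.exp (1 / t) * Real.exp (-(1 / (4 * t) * ‖v‖ ^ 2))))
      (Eventually.of_forall fun z => (continuous_kernelDefect t z).measurable.enorm.mul
        (measurable_weight n t)) ?_
      ((integrable_exp_neg n (b := 1 / (4 * t)) (by positivity)).const_mul _).lintegral_lt_top.ne
      (Eventually.of_forall fun v => ?_)
    · filter_upwards [Metric.closedBall_mem_nhds (0 : Cn n) one_pos] with z hz
      refine Eventually.of_forall fun v => ?_
      rw [mem_closedBall_zero_iff] at hz
      rw [weight, ← ofReal_norm, ← ENNReal.ofReal_mul (norm_nonneg _)]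
      refine ENNReal.ofReal_le_ofReal ?_
      calc _ ≤ 2 * Real.exp (‖v‖ / t) * Real.exp (-(‖v‖ ^ 2 / (2 * t))) :=
            mul_le_mul_of_nonneg_right (norm_kernelDefect_le ht hz v) (Real.exp_pos _).le
        _ ≤ _ := by
          rw [mul_assoc, mul_assoc, ← Real.exp_add, ← Real.exp_add]
          refine mul_le_mul_of_nonneg_left (Real.exp_le_exp.2 ?_) zero_le_two
          -- Completing the square shows |v|/t ≤ 1/t + |v|²/(4t), so half of the Gaussian decay
          -- remains.
          have h2 : 0 ≤ (‖v‖ / 2 - 1) ^ 2 / t := by positivity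
          have h3 : (‖v‖ / 2 - 1) ^ 2 / t = 1 / t + -(1 / (4 * t) * ‖v‖ ^ 2) -
              (‖v‖ / t + -(‖v‖ ^ 2 / (2 * t))) := by
            field_simp; ring
          linarith
    · have hc : Continuous fun z : Cn n => kernelDefect t z v := by
        unfold kernelDefect; fun_prop
      have h0 := (hc.tendsto 0).enorm
      have h2 : kernelDefect t (0 : Cn n) v = 0 := by simp [kernelDefect]
      rw [h2, enorm_zero] at h0
      simpa using ENNReal.Tendsto.mul_const (b := weight t v) h0 (Or.inr ENNReal.ofReal_ne_top)
  have h2 := ENNReal.Tendsto.const_mul (a := ENNReal.ofReal (1 / (Real.pi * t) ^ n)) h1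
    (Or.inr ENNReal.ofReal_ne_top)
  rwa [lintegral_zero, mul_zero] at h2

/-- From -2|w|² + 2 Re(z·w̄) - |z|² = -|z - w|² - |w|²: conjugated by the weight, the Bergman kernel
has the modulus of a convolution kernel. -/
theorem enorm_gaussian_mul_kernel (ht : 0 < t) (z w : Cn n) :
    ‖(gaussian n t w : ℂ)‖ₑ * ‖Complex.exp (inner ℂ w z / t)‖ₑ * weight t z =
      ENNReal.ofReal (1 / (Real.pi * t) ^ n) * (weight t (z - w) * weight t w) := by
  have hpi := Real.pi_pos
  rw [← ofReal_norm, ← ofReal_norm, Complex.norm_of_nonneg (gaussian_pos n ht w).le, weight,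
    weight, weight, ← ENNReal.ofReal_mul (gaussian_pos n ht w).le,
    ← ENNReal.ofReal_mul (mul_nonneg (gaussian_pos n ht w).le (norm_nonneg _)),
    ← ENNReal.ofReal_mul (Real.exp_pos _).le, ← ENNReal.ofReal_mul (by positivity)]
  congr 1
  rw [gaussian, Complex.norm_exp, mul_assoc, mul_assoc, ← Real.exp_add, ← Real.exp_add,
    ← Real.exp_add, Complex.div_ofReal_re, @norm_sub_sq ℂ, ← inner_re_symm]
  congr 2
  simp only [RCLike.re_to_complex]
  field_simp
  ring

/-- Multiplying the Bergman kernel by a factor controlled by β(z - w) keeps it dominated by a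
convolution kernel, and Young's inequality gives the bound. -/
theorem eLpNorm_le_of_kernel (hp : 1 < p) (ht : 0 < t) {F h : Cn n → ℂ}
    (hm : AEStronglyMeasurable h) {b : Cn n → Cn n → ℂ} {β : Cn n → ℝ≥0∞} (hβ : Measurable β)
    (hb : ∀ z w, ‖b z w‖ₑ ≤ β (z - w))
    (hF : ∀ z, F z = ∫ w, (gaussian n t w : ℂ) * (Complex.exp (inner ℂ w z / t) * (b z w * h w))) :
    eLpNorm F (ENNReal.ofReal p) (gaussianMeasure n (2 * t / p)) ≤
      (ENNReal.ofReal (1 / (Real.pi * t) ^ n) * ∫⁻ v, β v * weight t v) *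
        eLpNorm h (ENNReal.ofReal p) (gaussianMeasure n (2 * t / p)) := by
  rw [← lintegral_const_mul' _ _ ENNReal.ofReal_ne_top]
  refine eLpNorm_le_of_le_convolution hp ht hm
    ((hβ.mul (measurable_weight n t)).const_mul _) fun z => ?_
  rw [hF]
  refine (mul_le_mul_left (enorm_integral_le_lintegral_enorm _) _).trans ?_
  rw [← lintegral_mul_const' (weight t z) _ ENNReal.ofReal_ne_top]
  refine lintegral_mono fun w => ?_
  rw [enorm_mul, enorm_mul, enorm_mul]
  calc _ = (‖(gaussian n t w : ℂ)‖ₑ * ‖Complex.exp (inner ℂ w z / t)‖ₑ * weight t z) *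
        (‖b z w‖ₑ * ‖h w‖ₑ) := by ring
    _ ≤ (‖(gaussian n t w : ℂ)‖ₑ * ‖Complex.exp (inner ℂ w z / t)‖ₑ * weight t z) *
        (β (z - w) * ‖h w‖ₑ) := by gcongr; exact hb z w
    _ = _ := by rw [enorm_gaussian_mul_kernel ht]; ring

theorem eLpNorm_phase_mul (z : Cn n) (h : Cn n → ℂ) :
    eLpNorm (fun w => phase t z w * h w) (ENNReal.ofReal p) (gaussianMeasure n (2 * t / p)) =
      eLpNorm h (ENNReal.ofReal p) (gaussianMeasure n (2 * t / p)) :=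
  eLpNorm_congr_norm_ae (Eventually.of_forall fun w => by rw [norm_mul, norm_phase, one_mul])

theorem memLp_phase_mul (z : Cn n) {h : Cn n → ℂ}
    (hh : MemLp h (ENNReal.ofReal p) (gaussianMeasure n (2 * t / p))) :
    MemLp (fun w => phase t z w * h w) (ENNReal.ofReal p) (gaussianMeasure n (2 * t / p)) :=
  ⟨(continuous_phase t z).aestronglyMeasurable.mul hh.1, by rw [eLpNorm_phase_mul]; exact hh.2⟩

end

variable {n : ℕ} {p t : ℝ} [Fact (1 < p)] [Fact (0 < t)]

/-- Expand both terms at w by the reproducing formula over u. Their kernels differ by the unimodular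
phase at w times a defect depending only on w - u. -/
theorem eLpNorm_weyl_sub_phase_mul_le (z : Cn n) (g : FockSpace n p t) :
    eLpNorm (fun w => weyl z g w - phase t z w * g w) (ENNReal.ofReal p)
      (gaussianMeasure n (2 * t / p)) ≤ weylDefect n t z * ‖g‖ₑ := by
  have ht : 0 < t := Fact.out
  have hp : 1 < p := Fact.out
  rw [FockSpace.enorm_eq]
  have hgm := g.continuous.aestronglyMeasurable (μ := volume)
  have hi := integrable_bergmanProj hp ht hgm g.weightedLint_ne_top
  refine eLpNorm_le_of_kernel hp ht hgm (continuous_kernelDefect t z).measurable.enorm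
    (b := fun w u => phase t z w * kernelDefect t z (w - u)) (fun w u => ?_) fun w => ?_
  · rw [enorm_mul, ← ofReal_norm (phase t z w), norm_phase, ENNReal.ofReal_one, one_mul]
  · rw [weyl_apply, ← g.bergmanProj_eq w, ← g.bergmanProj_eq (w - z), bergmanProj, bergmanProj,
      integral_gaussianMeasure n ht, integral_gaussianMeasure n ht, ← integral_const_mul,
      ← integral_const_mul, ← integral_sub ((hi _).const_mul _) ((hi _).const_mul _)]
    refine integral_congr_ae (Eventually.of_forall fun u => ?_)
    have key : normalizedKernel t z w * Complex.exp (inner ℂ u (w - z) / t) =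
        Complex.exp (inner ℂ u w / t) * phase t z w *
          Complex.exp (inner ℂ (w - u) z / t - (‖z‖ ^ 2 / (2 * t) : ℝ)) := by
      rw [normalizedKernel, phase, ← Complex.exp_add, ← Complex.exp_add, ← Complex.exp_add]
      congr 1
      simp only [inner_sub_left, inner_sub_right]
      ring
    simp only [kernelDefect]
    linear_combination ((gaussian n t u : ℂ) * g u) * key

/-- Same comparison with the phase taken at the integration variable u instead of w, so that it can
be placed inside the projection: W_z P ≈ P u_z. -/
theorem eLpNorm_weyl_bergman_sub_le (z : Cn n) {h : Cn n → ℂ}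
    (hh : MemLp h (ENNReal.ofReal p) (gaussianMeasure n (2 * t / p)))
    (hzh : MemLp (fun w => phase t z w * h w) (ENNReal.ofReal p) (gaussianMeasure n (2 * t / p))) :
    ‖weyl z (bergman h hh) - bergman _ hzh‖ₑ ≤ weylDefect n t z *
      eLpNorm h (ENNReal.ofReal p) (gaussianMeasure n (2 * t / p)) := by
  have ht : 0 < t := Fact.out
  have hp : 1 < p := Fact.out
  rw [FockSpace.enorm_eq]
  have hi := integrable_bergmanProj hp ht hh.aestronglyMeasurable_volume hh.weightedLint_ne_top
  have hi2 := integrable_bergmanProj hp ht hzh.aestronglyMeasurable_volume hzh.weightedLint_ne_top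
  refine eLpNorm_le_of_kernel hp ht hh.aestronglyMeasurable_volume
    (continuous_kernelDefect t z).measurable.enorm
    (b := fun w u => phase t z u *
      (Complex.exp (inner ℂ z (w - u) / t - (‖z‖ ^ 2 / (2 * t) : ℝ)) - 1)) (fun w u => ?_)
    fun w => ?_
  · rw [enorm_mul, ← ofReal_norm, norm_phase, ENNReal.ofReal_one, one_mul, ← ofReal_norm,
      norm_kernelDefect_conj, ofReal_norm]
  · rw [FockSpace.sub_apply, weyl_apply, bergman_apply, bergman_apply, bergmanProj, bergmanProj,
      integral_gaussianMeasure n ht, integral_gaussianMeasure n ht, ← integral_const_mul,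
      ← integral_sub ((hi _).const_mul _) (hi2 _)]
    refine integral_congr_ae (Eventually.of_forall fun u => ?_)
    have key : normalizedKernel t z w * Complex.exp (inner ℂ u (w - z) / t) =
        Complex.exp (inner ℂ u w / t) * phase t z u *
          Complex.exp (inner ℂ z (w - u) / t - (‖z‖ ^ 2 / (2 * t) : ℝ)) := by
      rw [normalizedKernel, phase, ← Complex.exp_add, ← Complex.exp_add, ← Complex.exp_add]
      congr 1
      simp only [inner_sub_right]
      ring
    simp only
    linear_combination ((gaussian n t u : ℂ) * h u) * key

theorem eLpNorm_LInfty_mul_le (f : LInfty n) (h : Cn n → ℂ) :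
    eLpNorm (fun w => f w * h w) (ENNReal.ofReal p) (gaussianMeasure n (2 * t / p)) ≤
      ‖f‖ₑ * eLpNorm h (ENNReal.ofReal p) (gaussianMeasure n (2 * t / p)) :=
  eLpNorm_le_mul_of_weightedLint_le (lt_trans one_pos Fact.out) Fact.out
    (weightedLint_mul_le (lt_trans one_pos Fact.out) f h)

theorem memLp_LInfty_mul (f : LInfty n) {h : Cn n → ℂ}
    (hh : MemLp h (ENNReal.ofReal p) (gaussianMeasure n (2 * t / p))) :
    MemLp (fun w => f w * h w) (ENNReal.ofReal p) (gaussianMeasure n (2 * t / p)) :=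
  ⟨((Lp.aestronglyMeasurable f).mono_ac (gaussianMeasure_absolutelyContinuous n _)).mul hh.1,
    (eLpNorm_LInfty_mul_le f h).trans_lt (ENNReal.mul_lt_top enorm_lt_top hh.2)⟩

theorem toeplitz_eq_bergman (f : LInfty n) (g : FockSpace n p t) :
    toeplitz f g = bergman (fun w => f w * g w) (memLp_LInfty_mul f g.memLp) := rfl

/-- Replace W_z P by P u_z on the left and W_{-z} by u_{-z} on the right. The two phases cancel
across f, leaving T_f; each replacement costs one defect. -/
theorem enorm_translate_toeplitz_sub_le (f : LInfty n) (z : Cn n) (g : FockSpace n p t) :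
    ‖translate z (toeplitz f) g - toeplitz f g‖ₑ ≤
      (weylDefect n t z + bergmanBound n t * weylDefect n t (-z)) * ‖f‖ₑ * ‖g‖ₑ := by
  set g' := weyl (-z) g with hg'
  have hng : ‖g'‖ₑ = ‖g‖ₑ := by rw [← ofReal_norm, norm_weyl, ofReal_norm]
  set h := fun w => f w * g' w with hh
  have hm := memLp_LInfty_mul f g'.memLp
  have hm2 := memLp_phase_mul z hm
  have h1 : ‖weyl z (bergman h hm) - bergman _ hm2‖ₑ ≤ weylDefect n t z * (‖f‖ₑ * ‖g‖ₑ) := by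
    refine (eLpNorm_weyl_bergman_sub_le z hm hm2).trans ?_
    rw [← hng, FockSpace.enorm_eq]
    exact mul_le_mul_right (eLpNorm_LInfty_mul_le f _) _
  have h2 : ‖bergman _ hm2 - toeplitz f g‖ₑ ≤
      bergmanBound n t * (‖f‖ₑ * (weylDefect n t (-z) * ‖g‖ₑ)) := by
    rw [toeplitz_eq_bergman, ← bergman_sub]
    refine (enorm_bergman_le _ _).trans (mul_le_mul_right ?_ _)
    have h3 : ((fun w => phase t z w * h w) - fun w => f w * g w) =
        fun w => phase t z w * (f w * (g' w - phase t (-z) w * g w)) := by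
      funext w
      simp only [Pi.sub_apply, hh]
      linear_combination (f w * g w) * phase_mul_phase_neg t z w
    rw [h3, eLpNorm_phase_mul]
    exact (eLpNorm_LInfty_mul_le f _).trans
      (mul_le_mul_right (eLpNorm_weyl_sub_phase_mul_le (-z) g) _)
  calc ‖translate z (toeplitz f) g - toeplitz f g‖ₑ
      = ‖(weyl z (bergman h hm) - bergman _ hm2) + (bergman _ hm2 - toeplitz f g)‖ₑ := by
        rw [sub_add_sub_cancel]
        rfl
    _ ≤ _ := (enorm_add_le _ _).trans (add_le_add h1 h2)
    _ = _ := by ring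

theorem toeplitz_mem_normContinuousOperators (f : LInfty n) :
    (toeplitz f : FockSpace n p t →L[ℂ] FockSpace n p t) ∈ normContinuousOperators n p t := by
  have ht : 0 < t := Fact.out
  rw [mem_normContinuousOperators_iff]
  have h1 := tendsto_weylDefect n ht
  have h2 : Tendsto (fun z : Cn n => weylDefect n t (-z)) (𝓝 0) (𝓝 0) := by
    refine h1.comp ?_
    simpa using (continuous_neg (G := Cn n)).tendsto 0
  have h3 := ENNReal.Tendsto.mul_const (b := ‖f‖ₑ) (h1.add (ENNReal.Tendsto.const_mul
    (a := bergmanBound n t) h2 (Or.inr (bergmanBound_ne_top n ht)))) (Or.inr enorm_ne_top)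
  rw [mul_zero, add_zero, zero_mul] at h3
  refine Metric.tendsto_nhds.2 fun ε hε => ?_
  filter_upwards [(ENNReal.tendsto_nhds_zero.1 h3) (ENNReal.ofReal (ε / 2)) (by simpa using hε)]
    with z hz
  rw [dist_zero_right, norm_norm]
  refine lt_of_le_of_lt (ContinuousLinearMap.opNorm_le_bound _ (half_pos hε).le fun g => ?_)
    (half_lt_self hε)
  have h4 := (enorm_translate_toeplitz_sub_le f z g).trans (mul_le_mul_left hz ‖g‖ₑ)
  rw [← ofReal_norm, ← ofReal_norm g, ← ENNReal.ofReal_mul (half_pos hε).le] at h4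
  exact (ENNReal.ofReal_le_ofReal_iff (by positivity)).1 h4

theorem toeplitzAlgebra_le_normContinuousAlgebra (S : Set (LInfty n)) :
    toeplitzAlgebra n p t S ≤ normContinuousAlgebra n p t := by
  refine NonUnitalSubalgebra.topologicalClosure_minimal (NonUnitalAlgebra.adjoin_le ?_)
    isClosed_normContinuousOperators
  rintro _ ⟨f, -, rfl⟩
  exact toeplitz_mem_normContinuousOperators f

end

section

variable {n : ℕ} {p t : ℝ}

/-! ### Reproducing kernels -/

theorem weightedLint_one_ne_top (hp : 0 < p) (ht : 0 < t) :
    weightedLint p t (fun _ : Cn n => (1 : ℂ)) ≠ ∞ := by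
  refine ne_of_eq_of_ne (lintegral_congr fun w => ?_) (lintegral_weight_rpow_ne_top n ht hp)
  rw [enorm_one, one_mul, weight]

instance isFiniteMeasure_gaussianMeasure [Fact (0 < t)] : IsFiniteMeasure (gaussianMeasure n t) :=
  isFiniteMeasure_withDensity_ofReal (integrable_gaussian n Fact.out).2

variable [Fact (1 < p)] [Fact (0 < t)]

variable (n p t) in
/-- The constant function `1` as an element of `F_t^p`. -/
def fockOne : FockSpace n p t :=
  FockSpace.mk' (fun _ => 1) (differentiable_const 1)
    (weightedLint_one_ne_top (lt_trans one_pos Fact.out) Fact.out)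

theorem fockOne_apply (w : Cn n) : fockOne n p t w = 1 := rfl

variable (p t) in
/-- The reproducing kernel `K_u(w) = exp (w · ū / t)` as an element of `F_t^p`. -/
def reprKernel (u : Cn n) : FockSpace n p t :=
  Complex.exp ((‖u‖ ^ 2 / (2 * t) : ℝ)) • weyl u (fockOne n p t)

theorem reprKernel_apply (u w : Cn n) : reprKernel p t u w = Complex.exp (inner ℂ u w / t) := by
  rw [reprKernel, FockSpace.smul_apply, weyl_apply, fockOne_apply, mul_one, normalizedKernel,
    ← Complex.exp_add, add_sub_cancel]

theorem continuous_reprKernel : Continuous fun u : Cn n => reprKernel p t u := by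
  have h : Continuous fun u : Cn n => Complex.exp ((‖u‖ ^ 2 / (2 * t) : ℝ)) := by fun_prop
  exact h.smul (continuous_weyl_apply _)

/-- Compact support makes the integral of kernels converge in the Fock space itself, so a bounded
operator that kills all kernels also kills P h. -/
theorem bergman_eq_integral_reprKernel {h : Cn n → ℂ} (hc : Continuous h)
    (hs : HasCompactSupport h)
    (hh : MemLp h (ENNReal.ofReal p) (gaussianMeasure n (2 * t / p))) :
    Integrable (fun u => ((gaussian n t u : ℂ) * h u) • reprKernel p t u) ∧
      bergman h hh = ∫ u, ((gaussian n t u : ℂ) * h u) • reprKernel p t u := by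
  have hg : Continuous fun u : Cn n => (gaussian n t u : ℂ) :=
    Complex.continuous_ofReal.comp (continuous_gaussian n t)
  have hi : Integrable fun u => ((gaussian n t u : ℂ) * h u) • reprKernel p t u :=
    Continuous.integrable_of_hasCompactSupport ((hg.mul hc).smul continuous_reprKernel)
      hs.mul_left.smul_right
  refine ⟨hi, FockSpace.ext fun z => ?_⟩
  rw [← evalCLM_apply z (∫ u, _), ← ContinuousLinearMap.integral_comp_comm _ hi, bergman_apply,
    bergmanProj, integral_gaussianMeasure n Fact.out]
  refine integral_congr_ae (Eventually.of_forall fun u => ?_)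
  simp only
  rw [map_smul, evalCLM_apply, reprKernel_apply, smul_eq_mul]
  ring

/-- A bounded operator that vanishes on the reproducing kernels is zero. -/
theorem eq_zero_of_apply_reprKernel {D : FockSpace n p t →L[ℂ] FockSpace n p t}
    (hD : ∀ u, D (reprKernel p t u) = 0) : D = 0 := by
  have hp : 1 < p := Fact.out
  have ht : 0 < t := Fact.out
  -- This makes the measure of the norm finite, as used for approximation in L^p by compactly
  -- supported continuous functions.
  have : Fact (0 < 2 * t / p) := ⟨by positivity⟩
  ext1 g
  rw [_root_.zero_apply, ← norm_le_zero_iff]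
  refine le_of_forall_pos_le_add fun ε hε => ?_
  set C := ‖D‖ * (bergmanBound n t).toReal
  have hC : 0 ≤ C := by positivity
  set δ := ε / (C + 1)
  have hδ : 0 < δ := by positivity
  obtain ⟨h, hs, hgh, hc, hh⟩ := g.memLp.exists_hasCompactSupport_eLpNorm_sub_le
    ENNReal.ofReal_ne_top (ε := ENNReal.ofReal δ) (by simpa using hδ)
  have hDh : D (bergman h hh) = 0 := by
    obtain ⟨hi, he⟩ := bergman_eq_integral_reprKernel hc hs hh
    rw [he, ← ContinuousLinearMap.integral_comp_comm _ hi]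
    simp only [map_smul, hD, smul_zero, integral_zero]
  have h1 : ‖g - bergman h hh‖ₑ ≤ bergmanBound n t * ENNReal.ofReal δ :=
    (g.enorm_sub_bergman_le h hh).trans (mul_le_mul_right hgh _)
  have h2 := ENNReal.toReal_mono (ENNReal.mul_ne_top (bergmanBound_ne_top n ht)
    ENNReal.ofReal_ne_top) h1
  rw [toReal_enorm, ENNReal.toReal_mul, ENNReal.toReal_ofReal hδ.le] at h2
  calc ‖D g‖ = ‖D (g - bergman h hh)‖ := by rw [map_sub, hDh, sub_zero]
    _ ≤ ‖D‖ * ‖g - bergman h hh‖ := D.le_opNorm _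
    _ ≤ ‖D‖ * ((bergmanBound n t).toReal * δ) := by gcongr
    _ = C * δ := by ring
    _ ≤ 0 + ε := by
      rw [zero_add, ← mul_div_assoc, div_le_iff₀ (by positivity)]
      nlinarith

/-! ### Holomorphic functions with values in the Fock space -/

/-- A continuous Fock space valued function is holomorphic if it is so pointwise. -/
theorem differentiable_of_differentiable_apply {f : ℂ → FockSpace n p t} (hf : Continuous f)
    (hd : ∀ w, Differentiable ℂ fun l => f l w) : Differentiable ℂ f := by
  intro l₀
  set R : ℝ≥0 := ‖l₀‖₊ + 1
  have hR : 0 < R := by positivity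
  have hci : CircleIntegrable f 0 R := hf.continuousOn.circleIntegrable R.2
  -- The Cauchy integral of f over a circle around l₀ is holomorphic with values in the Banach
  -- space. It equals f because point evaluations commute with the integral and the scalar Cauchy
  -- formula holds at each w.
  have h1 := (hasFPowerSeriesOn_cauchy_integral hci hR).differentiableOn
  rw [Metric.eball_coe] at h1
  have hmem : l₀ ∈ Metric.ball (0 : ℂ) R := by
    rw [mem_ball_zero_iff]
    change ‖l₀‖ < ‖l₀‖ + 1
    exact lt_add_one _
  refine ((h1.congr fun l hl => ?_).differentiableAt (Metric.isOpen_ball.mem_nhds hmem))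
  refine FockSpace.ext fun w => ?_
  have h2 := (hd w).diffContOnCl (s := Metric.ball 0 (R : ℝ)) |>.two_pi_i_inv_smul_circleIntegral_sub_inv_smul
    hl
  have h3 : ContinuousOn (fun z => (z - l)⁻¹ • f z) (Metric.sphere 0 (R : ℝ)) := by
    refine ContinuousOn.smul
      (ContinuousOn.inv₀ (continuous_id.sub continuous_const).continuousOn fun z hz => ?_) hf.continuousOn
    rw [mem_sphere_zero_iff_norm] at hz
    rw [mem_ball_zero_iff] at hl
    intro h0
    have hzl : z = l := sub_eq_zero.1 h0
    rw [hzl] at hz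
    exact hl.ne hz
  have h4 : IntervalIntegrable (fun θ : ℝ => deriv (circleMap 0 (R : ℝ)) θ •
      (fun z => (z - l)⁻¹ • f z) (circleMap 0 (R : ℝ) θ)) volume 0 (2 * Real.pi) :=
    (h3.circleIntegrable R.2).out
  have h5 := (evalCLM (p := p) (t := t) w).intervalIntegral_comp_comm h4
  rw [FockSpace.smul_apply, ← evalCLM_apply w (∮ z in C(0, R), _), circleIntegral, ← h5, ← h2,
    smul_eq_mul, circleIntegral]
  congr 1

/-- Split f(l) = f(l₀) + (l - l₀) · (difference quotient). The first term is a composition of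
differentiable maps. The second vanishes at l₀, so continuity of the quotient evaluated at c(l)
suffices. -/
theorem differentiableAt_apply_of_differentiableAt {f : ℂ → FockSpace n p t} {c : ℂ → Cn n} {l₀ : ℂ}
    (hf : DifferentiableAt ℂ f l₀) (hc : DifferentiableAt ℂ c l₀) :
    DifferentiableAt ℂ (fun l => f l (c l)) l₀ := by
  have h1 : (fun l => f l (c l)) = fun l => f l₀ (c l) + (l - l₀) * (dslope f l₀ l) (c l) := by
    funext l
    have h2 := sub_smul_dslope f l₀ l
    have h3 : f l = f l₀ + (l - l₀) • dslope f l₀ l := by rw [h2, add_sub_cancel]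
    nth_rewrite 1 [h3]
    rfl
  rw [h1]
  refine DifferentiableAt.add (((f l₀).2.1 (c l₀)).comp l₀ hc) ?_
  have h4 : ContinuousAt (fun l => (dslope f l₀ l) (c l)) l₀ :=
    (continuous_uncurry_eval.tendsto (dslope f l₀ l₀, c l₀)).comp
      ((continuousAt_dslope_same.2 hf).prodMk_nhds hc.continuousAt)
  refine HasDerivAt.differentiableAt (f' := (dslope f l₀ l₀) (c l₀)) ?_
  rw [hasDerivAt_iff_tendsto_slope]
  refine (h4.tendsto.mono_left nhdsWithin_le_nhds).congr' ?_
  filter_upwards [self_mem_nhdsWithin] with l hl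
  have : l - l₀ ≠ 0 := sub_ne_zero.2 hl
  rw [slope_def_field, sub_self, zero_mul, sub_zero, mul_div_cancel_left₀ _ this]

/-! ### The Berezin transform -/

/-- The Berezin transform is injective. -/
theorem eq_zero_of_berezin_eq_zero {D : FockSpace n p t →L[ℂ] FockSpace n p t}
    (hD : ∀ z, D (reprKernel p t z) z = 0) : D = 0 := by
  refine eq_zero_of_apply_reprKernel fun u => FockSpace.ext fun ζ => ?_
  -- Chosen so that a + ib = ζ and a - ib = u. On the complex line a + lb, the kernel index a + l̄b
  -- agrees with the evaluation point for real l, and the pair becomes (u, ζ) at l = i.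
  set a : Cn n := (2⁻¹ : ℂ) • (ζ + u)
  set b : Cn n := (2⁻¹ * -Complex.I : ℂ) • (ζ - u)
  let κ : ℂ → FockSpace n p t := fun l => reprKernel p t (a + (starRingEnd ℂ l) • b)
  have hκc : Continuous κ := by
    refine continuous_reprKernel.comp ?_
    have := Complex.continuous_conj
    fun_prop
  -- The kernel is antiholomorphic in its index, and the conjugate of l in that index makes the
  -- dependence on l holomorphic.
  have hκ : Differentiable ℂ κ := by
    refine differentiable_of_differentiable_apply hκc fun w => ?_
    have h1 : (fun l => κ l w) = fun l => Complex.exp ((inner ℂ a w + l * inner ℂ b w) / t) := by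
      funext l
      simp only [κ]
      rw [reprKernel_apply, inner_add_left, inner_smul_left b w, Complex.conj_conj]
    rw [h1]
    fun_prop
  let φ : ℂ → ℂ := fun l => D (κ l) (a + l • b)
  have hφ : Differentiable ℂ φ := fun l =>
    differentiableAt_apply_of_differentiableAt (f := fun l => D (κ l))
      ((D.differentiable.comp hκ) l) (by fun_prop)
  have hreal : ∀ x : ℝ, φ x = 0 := fun x => by
    simp only [φ, κ, Complex.conj_ofReal]
    exact hD _
  -- The real zeros 1/(k+1) accumulate at 0, so the identity theorem carries the vanishing to l = i.
  have hfreq : ∃ᶠ l in 𝓝[≠] (0 : ℂ), φ l = 0 := by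
    have h1 : Tendsto (fun k : ℕ => (((1 / ((k : ℝ) + 1) : ℝ)) : ℂ)) atTop (𝓝[≠] 0) := by
      refine tendsto_nhdsWithin_iff.2 ⟨?_, Eventually.of_forall fun k => ?_⟩
      · rw [← Complex.ofReal_zero]
        exact (Complex.continuous_ofReal.tendsto 0).comp
          (tendsto_one_div_add_atTop_nhds_zero_nat (𝕜 := ℝ))
      · rw [Set.mem_compl_singleton_iff, Complex.ofReal_ne_zero]
        positivity
    exact h1.frequently (Frequently.of_forall fun k => hreal _)
  have hzero : φ = 0 := (Complex.analyticOnNhd_univ_iff_differentiable.2 hφ).eq_of_frequently_eq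
    (Complex.analyticOnNhd_univ_iff_differentiable.2 (differentiable_const 0)) hfreq
  have hI := congrFun hzero Complex.I
  have h1 : a + Complex.I • b = ζ := by
    simp only [a, b, smul_smul]
    rw [mul_left_comm, mul_neg, Complex.I_mul_I, neg_neg, mul_one, ← smul_add, add_add_sub_cancel,
      ← two_smul ℂ ζ, smul_smul, inv_mul_cancel₀ two_ne_zero, one_smul]
  have h2 : a + (starRingEnd ℂ Complex.I) • b = u := by
    simp only [a, b, smul_smul, Complex.conj_I]
    rw [mul_left_comm, neg_mul_neg, Complex.I_mul_I, mul_neg, mul_one, neg_smul, ← sub_eq_add_neg,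
      ← smul_sub, add_sub_sub_cancel, ← two_smul ℂ u, smul_smul, inv_mul_cancel₀ two_ne_zero,
      one_smul]
  simp only [φ, κ, h1, h2] at hI
  exact hI

/-- The Berezin transform `Ã(z) = ⟨A k_z, k_z⟩`. -/
def berezin (A : FockSpace n p t →L[ℂ] FockSpace n p t) (z : Cn n) : ℂ :=
  translate (-z) A (fockOne n p t) 0

theorem apply_reprKernel_self (A : FockSpace n p t →L[ℂ] FockSpace n p t) (z : Cn n) :
    A (reprKernel p t z) z = Complex.exp (inner ℂ z z / t) * berezin A z := by
  have ht : 0 < t := Fact.out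
  have htc : (t : ℂ) ≠ 0 := by exact_mod_cast ht.ne'
  rw [berezin, translate_apply, weyl_apply, neg_neg, sub_neg_eq_add, zero_add, reprKernel, map_smul,
    FockSpace.smul_apply, ← mul_assoc, normalizedKernel, ← Complex.exp_add]
  congr 2
  have h : ((‖z‖ : ℂ)) ^ 2 = inner ℂ z z := (inner_self_eq_norm_sq_to_K z).symm
  push_cast
  rw [norm_neg, h, inner_zero_right]
  field_simp
  ring

theorem norm_berezin_le (A : FockSpace n p t →L[ℂ] FockSpace n p t) (z : Cn n) :
    ‖berezin A z‖ ≤ ‖evalCLM (0 : Cn n) (p := p) (t := t)‖ * (‖A‖ * ‖fockOne n p t‖) :=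
  ((evalCLM (0 : Cn n)).le_opNorm (translate (-z) A (fockOne n p t))).trans
    (mul_le_mul_of_nonneg_left (norm_translate_apply_le _ _ _) (norm_nonneg _))

/-- The Berezin transform is a bounded functional composed with z ↦ α_{-z}(A), which is uniformly
continuous for A in C₁. -/
theorem uniformContinuous_berezin {A : FockSpace n p t →L[ℂ] FockSpace n p t}
    (hA : A ∈ normContinuousOperators n p t) : UniformContinuous (berezin A) := by
  set C := ‖evalCLM (0 : Cn n) (p := p) (t := t)‖ * ‖fockOne n p t‖
  have hL : LipschitzWith C.toNNReal fun B : FockSpace n p t →L[ℂ] FockSpace n p t =>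
      B (fockOne n p t) 0 := by
    refine LipschitzWith.of_dist_le_mul fun B B' => ?_
    rw [Real.coe_toNNReal _ (by positivity), dist_eq_norm, dist_eq_norm]
    have h : B (fockOne n p t) 0 - B' (fockOne n p t) 0 =
      evalCLM (0 : Cn n) ((B - B') (fockOne n p t)) := rfl
    rw [h, mul_assoc, mul_comm ‖fockOne n p t‖]
    exact (ContinuousLinearMap.le_opNorm _ _).trans
      (mul_le_mul_of_nonneg_left (ContinuousLinearMap.le_opNorm _ _) (norm_nonneg _))
  exact hL.uniformContinuous.comp ((uniformContinuous_translate hA).comp uniformContinuous_neg)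

theorem memLp_berezin {A : FockSpace n p t →L[ℂ] FockSpace n p t}
    (hA : A ∈ normContinuousOperators n p t) : MemLp (berezin A) ∞ (volume : Measure (Cn n)) :=
  memLp_top_of_bound (uniformContinuous_berezin hA).continuous.aestronglyMeasurable _
    (Eventually.of_forall (norm_berezin_le A))

theorem toLp_berezin_mem_BUC {A : FockSpace n p t →L[ℂ] FockSpace n p t}
    (hA : A ∈ normContinuousOperators n p t) : (memLp_berezin hA).toLp (berezin A) ∈ BUC n :=
  ⟨berezin A, uniformContinuous_berezin hA, ⟨_, norm_berezin_le A⟩, MemLp.coeFn_toLp _⟩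

theorem weyl_neg_reprKernel (z ζ : Cn n) : weyl (-z) (reprKernel p t ζ) =
    Complex.exp (inner ℂ ζ z / t - (‖z‖ ^ 2 / (2 * t) : ℝ)) • reprKernel p t (ζ - z) := by
  refine FockSpace.ext fun w => ?_
  rw [weyl_apply, FockSpace.smul_apply, reprKernel_apply, reprKernel_apply, normalizedKernel,
    ← Complex.exp_add, ← Complex.exp_add, norm_neg]
  congr 1
  simp only [inner_neg_left, inner_sub_left, inner_sub_right, inner_neg_right]
  ring

/-- The Gaussian average `f_t ∗ A` is the Toeplitz operator whose symbol is the Berezin transform. -/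
theorem conv_gaussian_eq_toeplitz {A : FockSpace n p t →L[ℂ] FockSpace n p t}
    (hA : A ∈ normContinuousOperators n p t) :
    conv (fun z : Cn n => (gaussian n t z : ℂ)) A =
      toeplitz ((memLp_berezin hA).toLp (berezin A)) := by
  have ht : 0 < t := Fact.out
  have htc : (t : ℂ) ≠ 0 := by exact_mod_cast ht.ne'
  rw [← sub_eq_zero]
  -- It suffices to compare the two operators on the kernel at ζ, evaluated at ζ. After z = ζ - w
  -- both become Gaussian integrals of the Berezin transform, with equal exponents.
  refine eq_zero_of_berezin_eq_zero fun ζ => ?_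
  rw [sub_apply, FockSpace.sub_apply, sub_eq_zero]
  have hg := integrable_ofReal_gaussian n ht
  have hi := integrable_smul_translate hg A (reprKernel p t ζ)
  rw [toeplitz_apply, integral_gaussianMeasure n ht, conv_apply hg, ← evalCLM_apply ζ (∫ z, _),
    ← ContinuousLinearMap.integral_comp_comm _ hi, ← integral_sub_left_eq_self _ volume ζ]
  refine integral_congr_ae ?_
  filter_upwards [(memLp_berezin hA).coeFn_toLp] with w hw
  rw [hw, map_smul, evalCLM_apply, translate_apply, weyl_neg_reprKernel, map_smul, map_smul,
    FockSpace.smul_apply, weyl_apply, sub_sub_cancel, apply_reprKernel_self, reprKernel_apply,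
    ofReal_gaussian, ofReal_gaussian, normalizedKernel, smul_eq_mul]
  have h : ∀ z : Cn n, ((‖z‖ : ℂ)) ^ 2 = inner ℂ z z := fun z =>
    (inner_self_eq_norm_sq_to_K z).symm
  have key : Complex.exp (-(inner ℂ (ζ - w) (ζ - w) / t)) *
      (Complex.exp (inner ℂ ζ (ζ - w) / t - (‖ζ - w‖ ^ 2 / (2 * t) : ℝ)) *
      (Complex.exp (inner ℂ (ζ - w) ζ / t - (‖ζ - w‖ ^ 2 / (2 * t) : ℝ)) *
        Complex.exp (inner ℂ w w / t))) =
      Complex.exp (-(inner ℂ w w / t)) * (Complex.exp (inner ℂ w ζ / t) *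
        Complex.exp (inner ℂ ζ w / t)) := by
    simp only [← Complex.exp_add]
    congr 1
    push_cast
    rw [h]
    simp only [inner_sub_left, inner_sub_right]
    field_simp
    ring
  linear_combination (1 / (Real.pi * t : ℂ) ^ n * berezin A w) * key

end

section

section

variable {n : ℕ}

/-! ### Gaussian averages of a bounded function -/

/-- Completing the square in z isolates the Gaussian of width s + r in w; integrating out the other
factor gives the semigroup law. -/
theorem gaussian_mul_gaussian_sub {s r : ℝ} (hs : 0 < s) (hr : 0 < r) (z w : Cn n) :
    gaussian n s z * gaussian n r (w - z) =
      gaussian n (s + r) w * gaussian n (s * r / (s + r)) (z - (s / (s + r)) • w) := by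
  have hpi := Real.pi_pos
  have h1 : 1 / (Real.pi * s) ^ n * (1 / (Real.pi * r) ^ n) =
      1 / (Real.pi * (s + r)) ^ n * (1 / (Real.pi * (s * r / (s + r))) ^ n) := by
    rw [one_div_mul_one_div, one_div_mul_one_div, ← mul_pow, ← mul_pow]
    congr 2
    field_simp
  have h2 : -(‖z‖ ^ 2 / s) + -(‖w - z‖ ^ 2 / r) =
      -(‖w‖ ^ 2 / (s + r)) + -(‖z - (s / (s + r)) • w‖ ^ 2 / (s * r / (s + r))) := by
    rw [@norm_sub_sq ℂ, @norm_sub_sq ℂ, norm_smul, Real.norm_of_nonneg (by positivity),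
      ← Complex.coe_smul, inner_smul_right, RCLike.re_to_complex, RCLike.re_to_complex,
      Complex.re_ofReal_mul, show (inner ℂ w z).re = (inner ℂ z w).re from inner_re_symm (𝕜 := ℂ) w z]
    field_simp
    ring
  calc _ = (1 / (Real.pi * s) ^ n * (1 / (Real.pi * r) ^ n)) *
        Real.exp (-(‖z‖ ^ 2 / s) + -(‖w - z‖ ^ 2 / r)) := by
        rw [gaussian, gaussian, Real.exp_add]; ring
    _ = _ := by rw [h1, h2, gaussian, gaussian, Real.exp_add]; ring

theorem integral_gaussian_mul_gaussian_sub {s r : ℝ} (hs : 0 < s) (hr : 0 < r) (w : Cn n) :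
    ∫ z, gaussian n s z * gaussian n r (w - z) = gaussian n (s + r) w := by
  simp_rw [gaussian_mul_gaussian_sub hs hr, integral_const_mul]
  rw [integral_sub_right_eq_self (gaussian n (s * r / (s + r))), integral_gaussian n (by positivity),
    mul_one]

theorem integral_gaussian_integral_gaussian {s r : ℝ} (hs : 0 < s) (hr : 0 < r) {b : Cn n → ℂ}
    (hb : Continuous b) {C : ℝ} (hC : ∀ z, ‖b z‖ ≤ C) :
    ∫ z, (gaussian n s z : ℂ) * ∫ w, (gaussian n r w : ℂ) * b (w + z) =
      ∫ w, (gaussian n (s + r) w : ℂ) * b w := by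
  have h1 : ∀ z : Cn n, (gaussian n s z : ℂ) * ∫ w, (gaussian n r w : ℂ) * b (w + z) =
      ∫ w, (gaussian n s z : ℂ) * (gaussian n r (w - z) : ℂ) * b w := fun z => by
    rw [← integral_sub_right_eq_self (fun w => (gaussian n r w : ℂ) * b (w + z)) z,
      ← integral_const_mul]
    simp_rw [sub_add_cancel, mul_assoc]
  have h2 := ((integrable_ofReal_gaussian n hs).convolution_integrand (ContinuousLinearMap.mul ℂ ℂ)
    (integrable_ofReal_gaussian n hr)).mul_bdd (g := fun q => b q.1) (c := C)
    (hb.comp continuous_fst).aestronglyMeasurable (Eventually.of_forall fun q => hC q.1)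
  simp only [ContinuousLinearMap.mul_apply'] at h2
  simp_rw [h1]
  rw [← integral_integral_swap (f := fun w z => (gaussian n s z : ℂ) * (gaussian n r (w - z) : ℂ) * b w)
    h2]
  refine integral_congr_ae (Eventually.of_forall fun w => ?_)
  simp only
  rw [integral_mul_const]
  congr 1
  rw [← integral_gaussian_mul_gaussian_sub hs hr w, ← integral_complex_ofReal]
  push_cast
  rfl

/-! ### Gaussian averages as a Laplace transform in the inverse width. -/

theorem norm_cexp_neg_mul_sq (l : ℂ) (z : Cn n) :
    ‖Complex.exp (-(l * (‖z‖ ^ 2 : ℝ)))‖ = Real.exp (-(l.re * ‖z‖ ^ 2)) := by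
  rw [Complex.norm_exp, Complex.neg_re, Complex.re_mul_ofReal]

theorem differentiableOn_integral_cexp_neg_mul_sq {b : Cn n → ℂ} (hb : Continuous b) {C : ℝ}
    (hC : ∀ z, ‖b z‖ ≤ C) :
    DifferentiableOn ℂ (fun l : ℂ => ∫ z, Complex.exp (-(l * (‖z‖ ^ 2 : ℝ))) * b z)
      {l | 0 < l.re} := by
  intro l₀ hl₀
  have hl₀ : 0 < l₀.re := hl₀
  set δ := l₀.re / 2 with hδ
  have hδ0 : 0 < δ := half_pos hl₀
  have hC0 : 0 ≤ C := (norm_nonneg _).trans (hC 0)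
  have hc : ∀ l : ℂ, Continuous fun z : Cn n => Complex.exp (-(l * (‖z‖ ^ 2 : ℝ))) * b z := fun l => by
    fun_prop
  have h := hasDerivAt_integral_of_dominated_loc_of_deriv_le (μ := (volume : Measure (Cn n)))
    (F := fun (l : ℂ) (z : Cn n) => Complex.exp (-(l * (‖z‖ ^ 2 : ℝ))) * b z)
    (F' := fun l z => Complex.exp (-(l * (‖z‖ ^ 2 : ℝ))) * -((‖z‖ ^ 2 : ℝ) : ℂ) * b z)
    (x₀ := l₀) (bound := fun z => 2 / δ * C * Real.exp (-(δ / 2 * ‖z‖ ^ 2)))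
    (s := {l | δ < l.re}) ?_ (Eventually.of_forall fun l => (hc l).aestronglyMeasurable) ?_ ?_ ?_ ?_ ?_
  · exact h.2.differentiableAt.differentiableWithinAt
  · exact (isOpen_lt continuous_const Complex.continuous_re).mem_nhds (half_lt_self hl₀)
  · refine Integrable.mono' ((integrable_exp_neg n hl₀).mul_const C) (hc l₀).aestronglyMeasurable
      (Eventually.of_forall fun z => ?_)
    rw [norm_mul, norm_cexp_neg_mul_sq]
    exact mul_le_mul_of_nonneg_left (hC z) (Real.exp_pos _).le
  · exact Continuous.aestronglyMeasurable (by fun_prop)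
  · refine Eventually.of_forall fun z l hl => ?_
    have hl : δ < l.re := hl
    rw [norm_mul, norm_mul, norm_cexp_neg_mul_sq, norm_neg, Complex.norm_of_nonneg (by positivity)]
    -- The factor |z|² produced by differentiation is absorbed by giving up half of the decay
    -- exp(-δ|z|²).
    have h1 : ‖z‖ ^ 2 ≤ 2 / δ * Real.exp (δ / 2 * ‖z‖ ^ 2) := by
      have h2 := Real.add_one_le_exp (δ / 2 * ‖z‖ ^ 2)
      have h3 : ‖z‖ ^ 2 = 2 / δ * (δ / 2 * ‖z‖ ^ 2) := by field_simp
      nth_rewrite 1 [h3]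
      exact mul_le_mul_of_nonneg_left (by linarith) (by positivity)
    have h4 : Real.exp (-(l.re * ‖z‖ ^ 2)) ≤ Real.exp (-(δ * ‖z‖ ^ 2)) :=
      Real.exp_le_exp.2 (neg_le_neg (mul_le_mul_of_nonneg_right hl.le (sq_nonneg _)))
    calc _ ≤ Real.exp (-(δ * ‖z‖ ^ 2)) * (2 / δ * Real.exp (δ / 2 * ‖z‖ ^ 2)) * C := by
          gcongr
          exact hC z
      _ = 2 / δ * C * (Real.exp (-(δ * ‖z‖ ^ 2)) * Real.exp (δ / 2 * ‖z‖ ^ 2)) := by ring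
      _ = _ := by
        rw [← Real.exp_add]
        congr 2
        ring
  · exact (integrable_exp_neg n (by positivity)).const_mul _
  · refine Eventually.of_forall fun z l _ => ?_
    have h1 : HasDerivAt (fun l : ℂ => -(l * ((‖z‖ ^ 2 : ℝ) : ℂ))) (-((‖z‖ ^ 2 : ℝ) : ℂ)) l := by
      have h2 := ((hasDerivAt_id l).mul_const ((‖z‖ ^ 2 : ℝ) : ℂ)).neg
      rwa [one_mul] at h2
    exact h1.cexp.mul_const (b z)

/-- If all sufficiently wide Gaussian averages of a bounded continuous function vanish at the origin,
then so does the function. -/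
theorem eq_zero_of_integral_gaussian_mul_eq_zero {b : Cn n → ℂ} (hb : Continuous b) {C : ℝ}
    (hC : ∀ z, ‖b z‖ ≤ C) {t : ℝ} (ht : 0 < t)
    (h : ∀ s > t, ∫ z, (gaussian n s z : ℂ) * b z = 0) : b 0 = 0 := by
  let G : ℂ → ℂ := fun l => ∫ z, Complex.exp (-(l * (‖z‖ ^ 2 : ℝ))) * b z
  have hpi := Real.pi_pos
  have hG : ∀ s > 0, ∫ z, (gaussian n s z : ℂ) * b z =
      ((1 / (Real.pi * s) ^ n : ℝ) : ℂ) * G ((1 / s : ℝ) : ℂ) := fun s hs => by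
    simp only [G]
    rw [← integral_const_mul]
    refine integral_congr_ae (Eventually.of_forall fun z => ?_)
    simp only
    rw [gaussian_eq_mul_exp, Complex.ofReal_mul, Complex.ofReal_exp]
    push_cast
    ring
  have hG0 : ∀ s > t, G ((1 / s : ℝ) : ℂ) = 0 := fun s hs => by
    have hs0 : 0 < s := ht.trans hs
    have h1 := h s hs
    rw [hG s hs0] at h1
    refine (mul_eq_zero.1 h1).resolve_left ?_
    exact Complex.ofReal_ne_zero.2 (by positivity)
  have hopen : IsOpen {l : ℂ | 0 < l.re} := isOpen_lt continuous_const Complex.continuous_re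
  -- With l = 1/s, the hypothesis kills G on the real interval (0, 1/t). Its interior point 1/(2t)
  -- is an accumulation point of zeros, so G vanishes on the whole half-plane, including at the
  -- narrow widths s ≤ t.
  have hfreq : ∃ᶠ l in 𝓝[≠] ((1 / (2 * t) : ℝ) : ℂ), G l = 0 := by
    have h1 : Tendsto (fun x : ℝ => (x : ℂ)) (𝓝[>] (1 / (2 * t))) (𝓝[≠] ((1 / (2 * t) : ℝ) : ℂ)) := by
      refine tendsto_nhdsWithin_iff.2 ⟨(Complex.continuous_ofReal.tendsto _).mono_left
        nhdsWithin_le_nhds, ?_⟩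
      filter_upwards [self_mem_nhdsWithin] with x hx
      rw [Set.mem_compl_singleton_iff, ne_eq, Complex.ofReal_inj]
      exact (Set.mem_Ioi.1 hx).ne'
    have hlt : 1 / (2 * t) < 1 / t := one_div_lt_one_div_of_lt ht (by linarith)
    refine h1.frequently (Eventually.frequently ?_)
    filter_upwards [Ioo_mem_nhdsGT hlt] with x hx
    have hx0 : 0 < x := lt_trans (by positivity) hx.1
    have := hG0 (1 / x) (by rw [gt_iff_lt, lt_one_div ht hx0]; exact hx.2)
    rwa [one_div_one_div] at this
  have hzero := ((differentiableOn_integral_cexp_neg_mul_sq hb hC).analyticOnNhd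
    hopen).eqOn_zero_of_preconnected_of_frequently_eq_zero
    (convex_halfSpace_re_gt 0).isPreconnected (z₀ := ((1 / (2 * t) : ℝ) : ℂ))
    (by rw [Set.mem_ofPred_eq, Complex.ofReal_re]; positivity) hfreq
  have h1 := tendsto_integral_gaussian_smul hb hC
  refine tendsto_nhds_unique (h1.congr' ?_) tendsto_const_nhds
  filter_upwards [self_mem_nhdsWithin] with s hs
  have hs : 0 < s := hs
  have h2 : G ((1 / s : ℝ) : ℂ) = 0 := hzero (by
    rw [Set.mem_ofPred_eq, Complex.ofReal_re]; positivity)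
  simp_rw [smul_eq_mul]
  rw [hG s hs, h2, mul_zero]

/-- Closedness makes the quotient by M a normed space in which x has nonzero image; Hahn-Banach
there gives a functional, pulled back along the quotient map. -/
theorem exists_clm_apply_ne_zero_of_notMem {X : Type*} [NormedAddCommGroup X] [NormedSpace ℂ X]
    {M : Submodule ℂ X} (hM : IsClosed (M : Set X)) {x : X} (hx : x ∉ M) :
    ∃ φ : X →L[ℂ] ℂ, (∀ y ∈ M, φ y = 0) ∧ φ x ≠ 0 := by
  have : IsClosed (M : Set X) := hM
  have h0 : ‖M.mkQL x‖ ≠ 0 := by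
    rw [norm_ne_zero_iff, Submodule.mkQL_apply, Submodule.mkQ_apply, ne_eq,
      Submodule.Quotient.mk_eq_zero]
    exact hx
  obtain ⟨g, -, hg⟩ := exists_dual_vector ℂ (M.mkQL x) h0
  refine ⟨g.comp M.mkQL, fun y hy => ?_, ?_⟩
  · rw [ContinuousLinearMap.comp_apply, Submodule.mkQL_apply, Submodule.mkQ_apply,
      (Submodule.Quotient.mk_eq_zero M).2 hy, map_zero]
  · rw [ContinuousLinearMap.comp_apply, hg]
    exact Complex.ofReal_ne_zero.2 h0

end

variable {n : ℕ} {p t : ℝ} [Fact (1 < p)] [Fact (0 < t)]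

/-! ### Norm continuous operators are limits of Toeplitz operators. -/

theorem clm_conv_gaussian (φ : (FockSpace n p t →L[ℂ] FockSpace n p t) →L[ℂ] ℂ)
    {A : FockSpace n p t →L[ℂ] FockSpace n p t} (hA : A ∈ normContinuousOperators n p t) {s : ℝ}
    (hs : 0 < s) : φ (conv (fun z : Cn n => (gaussian n s z : ℂ)) A) =
      ∫ z : Cn n, (gaussian n s z : ℂ) * φ (translate z A) := by
  obtain ⟨hi, he⟩ := conv_eq_integral (integrable_ofReal_gaussian n hs) hA
  rw [he, ← ContinuousLinearMap.integral_comp_comm _ hi]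
  simp_rw [map_smul, smul_eq_mul]

theorem translate_mem_normContinuousOperators (z : Cn n)
    {A : FockSpace n p t →L[ℂ] FockSpace n p t} (hA : A ∈ normContinuousOperators n p t) :
    translate z A ∈ normContinuousOperators n p t := by
  change Continuous fun w : Cn n => translate w (translate z A)
  simp_rw [translate_translate]
  exact Continuous.comp (g := fun w : Cn n => translate w A) hA (continuous_id.add continuous_const)

/-- A functional killing the BUC Toeplitz operators kills f_t * B for every B in C₁. Taking B =
f_{s-t} * A reaches all widths s > t, and analytic continuation in 1/s brings the width down to
zero. -/
theorem normContinuousOperators_subset_toeplitzLin :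
    normContinuousOperators n p t ⊆ toeplitzLin n p t (BUC n) := by
  have ht : 0 < t := Fact.out
  intro A hA
  by_contra hAM
  obtain ⟨φ, hφ, hφA⟩ := exists_clm_apply_ne_zero_of_notMem
    (Submodule.isClosed_topologicalClosure _) hAM
  have hφt : ∀ B ∈ normContinuousOperators n p t,
      φ (conv (fun z : Cn n => (gaussian n t z : ℂ)) B) = 0 := fun B hB => by
    rw [conv_gaussian_eq_toeplitz hB]
    exact hφ _ (Submodule.le_topologicalClosure _
      (Submodule.subset_span ⟨_, toLp_berezin_mem_BUC hB, rfl⟩))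
  let b : Cn n → ℂ := fun z => φ (translate z A)
  have hb : Continuous b := φ.continuous.comp hA
  have hC : ∀ z, ‖b z‖ ≤ ‖φ‖ * ‖A‖ := fun z => (φ.le_opNorm _).trans
    (mul_le_mul_of_nonneg_left (norm_translate_le z A) (norm_nonneg _))
  have hzero : b 0 = 0 := by
    refine eq_zero_of_integral_gaussian_mul_eq_zero hb hC ht fun s hs => ?_
    have hr : 0 < s - t := sub_pos.2 hs
    have hB := conv_mem_normContinuousOperators (integrable_ofReal_gaussian n hr) hA
    have h1 := hφt _ hB
    rw [clm_conv_gaussian φ hB ht] at h1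
    -- The average of b of width s is the f_t-average of its averages of width s - t, that is φ(f_t
    -- * (f_{s-t} * A)), which is zero.
    rw [← add_sub_cancel t s, ← integral_gaussian_integral_gaussian ht hr hb hC, ← h1]
    refine integral_congr_ae (Eventually.of_forall fun z => ?_)
    simp only [b]
    rw [translate_conv (integrable_ofReal_gaussian n hr),
      clm_conv_gaussian φ (translate_mem_normContinuousOperators z hA) hr]
    simp_rw [translate_translate]
  exact hφA (by rwa [← translate_zero A])

theorem toeplitzLin_subset_toeplitzAlgebra :
    (toeplitzLin n p t (BUC n) : Set (FockSpace n p t →L[ℂ] FockSpace n p t)) ⊆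
      toeplitzAlgebra n p t Set.univ := by
  refine closure_mono ?_
  have h : Submodule.span ℂ (toeplitz '' BUC n) ≤
      (NonUnitalAlgebra.adjoin ℂ (toeplitz (n := n) (p := p) (t := t) '' Set.univ)).toSubmodule :=
    Submodule.span_le.2 ((Set.image_mono (Set.subset_univ _)).trans
      (NonUnitalAlgebra.subset_adjoin ℂ))
  exact h

end

end Fock

end

/-! ### The chain of equalities. -/

theorem theoremA (n : ℕ) (p t : ℝ) [Fact (1 < p)] [Fact (0 < t)] :
    (toeplitzAlgebra n p t Set.univ : Set (FockSpace n p t →L[ℂ] FockSpace n p t)) =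
        toeplitzLin n p t (BUC n) ∧
      (toeplitzAlgebra n p t Set.univ : Set (FockSpace n p t →L[ℂ] FockSpace n p t)) =
        normContinuousOperators n p t ∧
      (toeplitzAlgebra n p t Set.univ : Set (FockSpace n p t →L[ℂ] FockSpace n p t)) =
        {A | Tendsto (fun s : ℝ => conv (fun z : Cn n => (gaussian n s z : ℂ)) A)
          (𝓝[>] 0) (𝓝 A)} ∧
      (toeplitzAlgebra n p t Set.univ : Set (FockSpace n p t →L[ℂ] FockSpace n p t)) =
        {B | ∃ g : Cn n → ℂ, Integrable g ∧ ∃ A ∈ normContinuousOperators n p t,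
          B = conv g A} := by
  have h1 : (toeplitzAlgebra n p t Set.univ : Set (FockSpace n p t →L[ℂ] FockSpace n p t)) ⊆
      normContinuousOperators n p t := toeplitzAlgebra_le_normContinuousAlgebra Set.univ
  have h2 := normContinuousOperators_subset_toeplitzLin (n := n) (p := p) (t := t)
  have h3 := toeplitzLin_subset_toeplitzAlgebra (n := n) (p := p) (t := t)
  have h4 : (toeplitzAlgebra n p t Set.univ : Set (FockSpace n p t →L[ℂ] FockSpace n p t)) =
      normContinuousOperators n p t := h1.antisymm (h2.trans h3)
  refine ⟨(h1.trans h2).antisymm h3, h4, ?_, ?_⟩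
  · rw [h4]
    refine Set.Subset.antisymm (fun A hA => tendsto_conv_gaussian hA) fun A hA => ?_
    -- Each f_s * A lies in the closed set C₁ whatever the bounded operator A, so the norm limit A
    -- does too.
    refine isClosed_normContinuousOperators.mem_of_tendsto hA ?_
    filter_upwards [self_mem_nhdsWithin] with s hs
    exact conv_mem_normContinuousOperators_of_integrable (integrable_ofReal_gaussian n hs) A
  · rw [h4]
    refine Set.Subset.antisymm (fun A hA => exists_eq_conv hA) ?_
    rintro _ ⟨g, hg, A, hA, rfl⟩
    exact conv_mem_normContinuousOperators hg hA
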